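/- Let $p$ be an odd prime and let $a\in\mathbb Q$ be such that for no $n\ge 1$ is $a$ the $p^n$-th power of a rational number. In a field $\Omega\supseteq\mathbb Q$ let $w_n,\zeta_n$ ($n\ge 0$) be such that $w_0=a$, $w_{n+1}^p=w_n$, $\zeta_n$ is a primitive $p^n$-th root of unity and $\zeta_{n+1}^p=\zeta_n$. Put $\mathbb Q(w_\infty)=\bigcup_n\mathbb Q(w_n)$, $N_n=\mathrm{Gal}(\mathbb Q(\zeta_n,w_n)/\mathbb Q(\zeta_n))$, $\Delta_n=\mathrm{Gal}(\mathbb Q(\zeta_n,w_n)/\mathbb Q(w_n))$, and let $H_n=(\mathbb Q(\zeta_n)[N_n])^{\Delta_n}$ be the fixed ring under the diagonal action of $\Delta_n$ (Galois action on coefficients, conjugation on $N_n$). (1) Each $H_n$ is a $\mathbb Q$-Hopf algebra, with comultiplication and counit restricted from the group algebra. The maps $\Omega[N_j]\to\Omega[N_i]$ ($i\le j$) induced by restriction of automorphisms restrict to bialgebra maps $\nu_{j,i}:H_j\to H_i$, and $\sum_\sigma c_\sigma\sigma\in H_n$ acts on $\mathbb Q(w_n)$ by $x\mapsto\sum_\sigma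 c_\sigma\sigma(x)$, making $\mathbb Q(w_n)$ an $H_n$-module algebra; $H_j$ acts on $\mathbb Q(w_i)\subseteq\mathbb Q(w_j)$ through $\nu_{j,i}$. Let $H_\infty=\varprojlim_n H_n$ be the resulting profinite Hopf algebra; its comultiplication $(h_n)\mapsto(\Delta(h_n))_n$ takes values in the completed tensor product $\varprojlim_n H_n\otimes H_n$, and it acts on $\mathbb Q(w_\infty)$ by letting $(h_n)$ act on $\mathbb Q(w_m)$ as $h_m$. Let $\mathbb Q(w_\infty)\#H_\infty$ be the (completed) smash product: the $\mathbb Q$-vector space $\varprojlim_n\mathbb Q(w_\infty)\otimes_{\mathbb Q}H_n$, with transition maps $1\otimes\nu_{j,i}$ and multiplication $(a\#h)(b\#h')=\sum a\,h_{(1)}(b)\# h_{(2)}h'$. (For $b\in\mathbb Q(w_m)$ with $m\ge n$, the $n$-th component of $\sum a\,h_{(1)}(b)\#h_{(2)}$ is computed from $a\otimes h_m\in\mathbb Q(w_\infty)\otimes H_m$ as $\sum a\,(h_m)_{(1)}(b)\otimes\nu_{m,n}((h_m)_{(2)})$.) (2) For every $n$: $\dim_{\mathbb Q}H_n=p^n$,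 and $\mathbb Q(w_n)/\mathbb Q$ is Hopf–Galois for $H_n$; in particular $a\# h\mapsto(b\mapsto a\,h(b))$ is an isomorphism of algebras $\mathbb Q(w_n)\#H_n\cong\mathrm{End}_{\mathbb Q}(\mathbb Q(w_n))$. For all $m\ge n$ the analogous maps $\mathbb Q(w_m)\otimes H_n\to\mathrm{Hom}_{\mathbb Q}(\mathbb Q(w_n),\mathbb Q(w_m))$ are bijective, and in the direct limit over $m$ they give a bijection of $\mathbb Q(w_\infty)\otimes H_n$ onto $\varinjlim_m\mathrm{Hom}_{\mathbb Q}(\mathbb Q(w_n),\mathbb Q(w_m))=\mathrm{Hom}_{\mathbb Q}(\mathbb Q(w_n),\mathbb Q(w_\infty))$. (3) There is an isomorphism of $\mathbb Q$-algebras $\Phi:\mathbb Q(w_\infty)\#H_\infty\to\mathrm{End}_{\mathbb Q}(\mathbb Q(w_\infty))$ that is the inverse limit of the bijections in (2): the restriction of $\Phi(x)$ to $\mathbb Q(w_n)$ is the image of the component of $x$ in $\mathbb Q(w_\infty)\otimes H_n$. In particular $\Phi(a\#h)(b)=a\,h(b)$. (4) $\mathbb Q(w_\infty)/\mathbb Q$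 is Hopf–Galois for $H_\infty$: $h(xy)=\sum h_{(1)}(x)h_{(2)}(y)$ for $h\in H_\infty$ and $x,y\in\mathbb Q(w_\infty)$ (computed, for $x,y\in\mathbb Q(w_n)$, with $\Delta(h_n)$); the algebra map $\mathbb Q(w_\infty)\#H_\infty\to\mathrm{End}_{\mathbb Q}(\mathbb Q(w_\infty))$ induced by the action is an isomorphism; and the $x\in\mathbb Q(w_\infty)$ with $h(x)=\varepsilon(h)x$ for all $h\in H_\infty$ are exactly the elements of $\mathbb Q$. -/

import Mathlib

open scoped TensorProduct

/-! ## Module algebras, smash products and Hopf-Galois actions -/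

section SmashMaps

/-- The linear map `A ⊗ H → Hom(B, A)`, `a ⊗ h ↦ (b ↦ a * h(b))`, for `H` acting on `B` with
values in `A`. -/
noncomputable def evalMap {k : Type*} [CommRing k] {A B H : Type*} [Ring A] [Algebra k A]
    [AddCommGroup B] [Module k B] [AddCommGroup H] [Module k H] (act : H →ₗ[k] B →ₗ[k] A) :
    A ⊗[k] H →ₗ[k] (B →ₗ[k] A) :=
  TensorProduct.lift ((LinearMap.lcomp k (B →ₗ[k] A) act).comp
    ((LinearMap.llcomp k B A A).comp (LinearMap.mul k A)))

theorem evalMap_tmul {k : Type*} [CommRing k] {A B H : Type*} [Ring A] [Algebra k A]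
    [AddCommGroup B] [Module k B] [AddCommGroup H] [Module k H] (act : H →ₗ[k] B →ₗ[k] A)
    (a : A) (h : H) (b : B) : evalMap act (a ⊗ₜ h) b = a * act h b := rfl

/-- The linear map `A ⊗ H → Hom(B, A ⊗ H')`, `a ⊗ h ↦ (b ↦ ∑ a * h₍₁₎(b) ⊗ ν(h₍₂₎))`. -/
noncomputable def twistMap {k : Type*} [CommRing k] {A B H H' : Type*} [Ring A] [Algebra k A]
    [AddCommGroup B] [Module k B] [AddCommGroup H] [Module k H] [Coalgebra k H]
    [AddCommGroup H'] [Module k H'] (act : H →ₗ[k] B →ₗ[k] A) (ν : H →ₗ[k] H') :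
    A ⊗[k] H →ₗ[k] (B →ₗ[k] A ⊗[k] H') :=
  TensorProduct.lift (LinearMap.mk₂ k
    (fun a h =>
      { toFun := fun b => TensorProduct.map (LinearMap.mulLeft k a ∘ₗ act.flip b) ν
          (Coalgebra.comul (R := k) h)
        map_add' := fun b b' => by
          simp only [map_add, LinearMap.comp_add, TensorProduct.map_add_left, LinearMap.add_apply]
        map_smul' := fun c b => by
          simp only [map_smul, LinearMap.comp_smul, TensorProduct.map_smul_left,
            LinearMap.smul_apply, RingHom.id_apply] })
    (fun a a' h => by
      ext b
      have : LinearMap.mulLeft k (a + a') = LinearMap.mulLeft k a + LinearMap.mulLeft k a' := by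
        ext; simp [add_mul]
      simp [this, LinearMap.add_comp, TensorProduct.map_add_left])
    (fun c a h => by
      ext b
      have : LinearMap.mulLeft k (c • a) = c • LinearMap.mulLeft k a := by ext; simp
      simp [this, LinearMap.smul_comp, TensorProduct.map_smul_left])
    (fun a h h' => by ext b; simp)
    (fun c a h => by ext b; simp))

theorem twistMap_tmul {k : Type*} [CommRing k] {A B H H' : Type*} [Ring A] [Algebra k A]
    [AddCommGroup B] [Module k B] [AddCommGroup H] [Module k H] [Coalgebra k H]
    [AddCommGroup H'] [Module k H'] (act : H →ₗ[k] B →ₗ[k] A) (ν : H →ₗ[k] H')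
    (a : A) (h : H) (b : B) : twistMap act ν (a ⊗ₜ h) b =
      TensorProduct.map (LinearMap.mulLeft k a ∘ₗ act.flip b) ν (Coalgebra.comul (R := k) h) := rfl

theorem twistMap_repr {k : Type*} [CommRing k] {A B H H' : Type*} [Ring A] [Algebra k A]
    [AddCommGroup B] [Module k B] [AddCommGroup H] [Module k H] [Coalgebra k H]
    [AddCommGroup H'] [Module k H'] (act : H →ₗ[k] B →ₗ[k] A) (ν : H →ₗ[k] H')
    (a : A) (h : H) (b : B) {ι : Type*} (𝓡 : Coalgebra.Repr k h ι) :
    twistMap act ν (a ⊗ₜ h) b =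
      ∑ i ∈ 𝓡.index, (a * act (𝓡.left i) b) ⊗ₜ[k] ν (𝓡.right i) := by
  rw [twistMap_tmul, ← 𝓡.eq, map_sum]
  rfl

/-- The extension of `f : B → A ⊗ H'` to a right `H'`-linear map `B ⊗ H' → A ⊗ H'`,
`b ⊗ h' ↦ f(b) * (1 ⊗ h')`. -/
noncomputable def extMap {k : Type*} [CommRing k] {A B H' : Type*} [Ring A] [Algebra k A]
    [AddCommGroup B] [Module k B] [Ring H'] [Algebra k H'] (f : B →ₗ[k] A ⊗[k] H') :
    B ⊗[k] H' →ₗ[k] A ⊗[k] H' :=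
  TensorProduct.lift (LinearMap.mk₂ k (fun b h' => f b * ((1 : A) ⊗ₜ[k] h'))
    (fun b b' h' => by rw [map_add, add_mul])
    (fun c b h' => by rw [map_smul, smul_mul_assoc])
    (fun b h' h'' => by rw [TensorProduct.tmul_add, mul_add])
    (fun c b h' => by rw [TensorProduct.tmul_smul, mul_smul_comm]))

theorem extMap_tmul {k : Type*} [CommRing k] {A B H' : Type*} [Ring A] [Algebra k A]
    [AddCommGroup B] [Module k B] [Ring H'] [Algebra k H'] (f : B →ₗ[k] A ⊗[k] H')
    (b : B) (h' : H') : extMap f (b ⊗ₜ h') = f b * ((1 : A) ⊗ₜ[k] h') := rfl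

theorem extMap_add {k : Type*} [CommRing k] {A B H' : Type*} [Ring A] [Algebra k A]
    [AddCommGroup B] [Module k B] [Ring H'] [Algebra k H'] (f g : B →ₗ[k] A ⊗[k] H')
    (y : B ⊗[k] H') : extMap (f + g) y = extMap f y + extMap g y := by
  induction y with
  | zero => simp
  | tmul b h => simp [extMap_tmul, add_mul]
  | add y z hy hz => simp only [map_add, hy, hz]; abel

theorem extMap_smul {k : Type*} [CommRing k] {A B H' : Type*} [Ring A] [Algebra k A]
    [AddCommGroup B] [Module k B] [Ring H'] [Algebra k H'] (c : k) (f : B →ₗ[k] A ⊗[k] H')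
    (y : B ⊗[k] H') : extMap (c • f) y = c • extMap f y := by
  induction y with
  | zero => simp
  | tmul b h => simp [extMap_tmul]
  | add y z hy hz => simp only [map_add, hy, hz, smul_add]

theorem extMap_zero {k : Type*} [CommRing k] {A B H' : Type*} [Ring A] [Algebra k A]
    [AddCommGroup B] [Module k B] [Ring H'] [Algebra k H'] (y : B ⊗[k] H') :
    extMap (0 : B →ₗ[k] A ⊗[k] H') y = 0 := by
  simpa using extMap_smul (0 : k) (0 : B →ₗ[k] A ⊗[k] H') y

/-- `extMap f` is right `H'`-linear. -/
theorem extMap_mul_right {k : Type*} [CommRing k] {A B H' : Type*} [Ring A] [Algebra k A]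
    [Ring B] [Algebra k B] [Ring H'] [Algebra k H'] (f : B →ₗ[k] A ⊗[k] H')
    (y : B ⊗[k] H') (h : H') :
    extMap f (y * ((1 : B) ⊗ₜ[k] h)) = extMap f y * ((1 : A) ⊗ₜ[k] h) := by
  induction y with
  | zero => simp
  | tmul b h' => simp [extMap_tmul, mul_assoc]
  | add y z hy hz => simp only [map_add, add_mul, hy, hz]

theorem extMap_comp_map {k : Type*} [CommRing k] {A B C H' : Type*} [Ring A] [Algebra k A]
    [AddCommGroup B] [Module k B] [AddCommGroup C] [Module k C]
    [Ring H'] [Algebra k H'] (f : B →ₗ[k] A ⊗[k] H') (g : C →ₗ[k] B) (y : C ⊗[k] H') :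
    extMap f (TensorProduct.map g .id y) = extMap (f ∘ₗ g) y := by
  induction y with
  | zero => simp
  | tmul b h' => simp [extMap_tmul]
  | add y z hy hz => simp only [map_add, hy, hz]

theorem map_extMap {k : Type*} [CommRing k] {A B H H' : Type*} [Ring A] [Algebra k A]
    [AddCommGroup B] [Module k B] [Ring H] [Algebra k H] [Ring H'] [Algebra k H']
    (ν : H →ₐ[k] H') (f : B →ₗ[k] A ⊗[k] H) (y : B ⊗[k] H) :
    TensorProduct.map .id ν.toLinearMap (extMap f y) =
      extMap (TensorProduct.map .id ν.toLinearMap ∘ₗ f) (TensorProduct.map .id ν.toLinearMap y) := by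
  have key : ∀ z : A ⊗[k] H, ∀ h : H, TensorProduct.map .id ν.toLinearMap (z * ((1 : A) ⊗ₜ[k] h)) =
      TensorProduct.map .id ν.toLinearMap z * ((1 : A) ⊗ₜ[k] ν h) := by
    intro z h
    induction z with
    | zero => simp
    | tmul a h' => simp
    | add y z hy hz => simp only [add_mul, map_add, hy, hz]
  induction y with
  | zero => simp
  | tmul b h => simp [extMap_tmul, key]
  | add y z hy hz => simp only [map_add, hy, hz]

theorem map_twistMap {k : Type*} [CommRing k] {A B H H' H'' : Type*} [Ring A] [Algebra k A]
    [AddCommGroup B] [Module k B] [AddCommGroup H] [Module k H] [Coalgebra k H]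
    [AddCommGroup H'] [Module k H'] [AddCommGroup H''] [Module k H'']
    (act : H →ₗ[k] B →ₗ[k] A) (ν : H →ₗ[k] H') (ν' : H' →ₗ[k] H'') (x : A ⊗[k] H) (b : B) :
    TensorProduct.map .id ν' (twistMap act ν x b) = twistMap act (ν' ∘ₗ ν) x b := by
  induction x with
  | zero => simp
  | tmul a h =>
    rw [twistMap_repr act _ a h b (Coalgebra.Repr.arbitrary k h),
      twistMap_repr act _ a h b (Coalgebra.Repr.arbitrary k h)]
    simp
  | add y z hy hz => simp only [map_add, LinearMap.add_apply, hy, hz]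

theorem twistMap_map {k : Type*} [CommRing k] {A B H H₀ H' : Type*} [Ring A] [Algebra k A]
    [AddCommGroup B] [Module k B] [AddCommGroup H] [Module k H] [Coalgebra k H]
    [AddCommGroup H₀] [Module k H₀] [Coalgebra k H₀]
    [AddCommGroup H'] [Module k H']
    (act : H →ₗ[k] B →ₗ[k] A) (ν : H →ₗ[k] H') (ν₀ : H₀ →ₗc[k] H) (x : A ⊗[k] H₀) (b : B) :
    twistMap act ν (TensorProduct.map .id ν₀.toLinearMap x) b =
      twistMap (act ∘ₗ ν₀.toLinearMap) (ν ∘ₗ ν₀.toLinearMap) x b := by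
  induction x with
  | zero => simp
  | tmul a h =>
    have h1 : Coalgebra.comul (R := k) (ν₀ h) =
        TensorProduct.map ν₀.toLinearMap ν₀.toLinearMap (Coalgebra.comul (R := k) h) :=
      (LinearMap.congr_fun ν₀.map_comp_comul h).symm
    rw [TensorProduct.map_tmul, twistMap_tmul, twistMap_tmul]
    erw [h1]
    rw [← LinearMap.comp_apply, ← TensorProduct.map_comp]
    rfl
  | add y z hy hz => simp only [map_add, LinearMap.add_apply, hy, hz]

theorem evalMap_map {k : Type*} [CommRing k] {A B H H₀ : Type*} [Ring A] [Algebra k A]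
    [AddCommGroup B] [Module k B] [AddCommGroup H] [Module k H] [AddCommGroup H₀] [Module k H₀]
    (act : H →ₗ[k] B →ₗ[k] A) (ν₀ : H₀ →ₗ[k] H) (x : A ⊗[k] H₀) (b : B) :
    evalMap act (TensorProduct.map .id ν₀ x) b = evalMap (act ∘ₗ ν₀) x b := by
  induction x with
  | zero => simp
  | tmul a h => rfl
  | add y z hy hz => simp only [map_add, LinearMap.add_apply, hy, hz]

end SmashMaps

/-- `A` is an `H`-module algebra through `act : H → End(A)`: one has
`h(ab) = ∑ h₍₁₎(a) h₍₂₎(b)` and `h(1) = ε(h) 1`. -/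
structure IsModuleAlgebra {k A H : Type*} [CommRing k] [Ring A] [Algebra k A] [Ring H]
    [Bialgebra k H] (act : H →ₐ[k] Module.End k A) : Prop where
  measuring : ∀ (h : H) (a b : A), act h (a * b) =
    LinearMap.mul' k A (TensorProduct.map (act.toLinearMap.flip a) (act.toLinearMap.flip b)
      (Coalgebra.comul (R := k) h))
  map_one : ∀ h : H, act h 1 = Coalgebra.counit (R := k) h • (1 : A)

section SmashIdentities

theorem IsModuleAlgebra.measuring_repr {k A H : Type*} [CommRing k] [Ring A] [Algebra k A]
    [Ring H] [Bialgebra k H] {act : H →ₐ[k] Module.End k A} (hA : IsModuleAlgebra act)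
    (h : H) (a b : A) {ι : Type*} (𝓡 : Coalgebra.Repr k h ι) :
    act h (a * b) = ∑ i ∈ 𝓡.index, act (𝓡.left i) a * act (𝓡.right i) b := by
  rw [hA.measuring, ← 𝓡.eq, map_sum, map_sum]
  rfl

/-- The identity behind associativity of smash products. -/
theorem twistMap_extMap {k A B C H₁ H₂ H₃ : Type*} [CommRing k] [Ring A] [Algebra k A]
    [Ring B] [Algebra k B] [Ring C] [Algebra k C] [Ring H₁] [Bialgebra k H₁] [Ring H₂]
    [Bialgebra k H₂] [Ring H₃] [Algebra k H₃] (j : B →ₐ[k] A) (i : C →ₐ[k] B)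
    {actB : H₁ →ₐ[k] Module.End k B} (hB : IsModuleAlgebra actB) (actC : H₂ →ₐ[k] Module.End k C)
    (ν₁ : H₁ →ₐc[k] H₂) (ν₂ : H₂ →ₐ[k] H₃)
    (hc : ∀ h c, i (actC (ν₁ h) c) = actB h (i c)) (φ : H₁ →ₗ[k] B →ₗ[k] A)
    (hφ : ∀ h b, φ h b = j (actB h b)) (ψ : H₂ →ₗ[k] C →ₗ[k] A)
    (hψ : ∀ h c, ψ h c = j (i (actC h c))) (θ : H₂ →ₗ[k] C →ₗ[k] B)
    (hθ : ∀ h c, θ h c = i (actC h c)) (ν₃ : H₁ →ₗ[k] H₃) (hν₃ : ∀ h, ν₃ h = ν₂ (ν₁ h))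
    (ν₁' : H₁ →ₗ[k] H₂) (hν₁ : ∀ h, ν₁' h = ν₁ h)
    (x : A ⊗[k] H₁) (y : B ⊗[k] H₂) (c : C) :
    twistMap ψ ν₂.toLinearMap (extMap (twistMap φ ν₁' x) y) c =
      extMap (twistMap φ ν₃ x) (twistMap θ ν₂.toLinearMap y c) := by
  induction x with
  | zero =>
    simp only [map_zero, extMap_zero, LinearMap.zero_apply]
  | add x x' hx hx' => simp only [map_add, extMap_add, LinearMap.add_apply, hx, hx']
  | tmul a h =>
    induction y with
    | zero => simp
    | add y y' hy hy' => simp only [map_add, LinearMap.add_apply, hy, hy']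
    | tmul b h' =>
      classical
      have hν : ∀ u v : H₁, TensorProduct.map (ν₁ : H₁ →ₗ[k] H₂) (ν₁ : H₁ →ₗ[k] H₂) (u ⊗ₜ v) =
        ν₁ u ⊗ₜ ν₁ v := fun u v => rfl
      let 𝓡 := Coalgebra.Repr.arbitrary k h
      let 𝓣 := Coalgebra.Repr.arbitrary k h'
      let 𝓛 := fun s => Coalgebra.Repr.arbitrary k (𝓡.left s)
      let 𝓢 := fun s => Coalgebra.Repr.arbitrary k (𝓡.right s)
      have hprod : ∀ (u : H₁) (𝓤 : Coalgebra.Repr k u (H₁ × H₁)) (α : A),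
          twistMap ψ ν₂.toLinearMap (α ⊗ₜ (ν₁ u * h')) c = ∑ t ∈ 𝓣.index, ∑ s ∈ 𝓤.index,
            (α * (j (actB (𝓤.left s) (i (actC (𝓣.left t) c))))) ⊗ₜ[k]
              (ν₂ (ν₁ (𝓤.right s)) * ν₂ (𝓣.right t)) := by
        intro u 𝓤 α
        have h1 : Coalgebra.comul (R := k) (ν₁ u) = ∑ s ∈ 𝓤.index,
            ν₁ (𝓤.left s) ⊗ₜ[k] ν₁ (𝓤.right s) := by
          have := (LinearMap.congr_fun ν₁.map_comp_comul u).symm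
          refine this.trans ?_
          rw [LinearMap.comp_apply, ← 𝓤.eq, map_sum]
          rfl
        rw [twistMap_tmul, Bialgebra.comul_mul, h1, ← 𝓣.eq, Finset.sum_mul_sum, map_sum,
          Finset.sum_comm]
        simp only [map_sum]
        refine Finset.sum_congr rfl fun t _ => Finset.sum_congr rfl fun s _ => ?_
        rw [Algebra.TensorProduct.tmul_mul_tmul, TensorProduct.map_tmul]
        simp [hψ, hc]
      let G : H₁ ⊗[k] (H₁ ⊗[k] H₁) → H₂ × H₂ → A ⊗[k] H₃ := fun z t =>
        ((a ⊗ₜ[k] (1 : H₃)) * (TensorProduct.lift ((LinearMap.mul k (A ⊗[k] H₃)).comp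
          (Algebra.TensorProduct.includeLeft (R := k) (S := k) (A := A) (B := H₃)).toLinearMap))
          (TensorProduct.map (φ.flip b) (TensorProduct.map
            (φ.flip (i (actC (𝓣.left t) c))) ν₃) z)) * ((1 : A) ⊗ₜ[k] ν₂ (𝓣.right t))
      have hG : ∀ (u v w : H₁) t, G (u ⊗ₜ (v ⊗ₜ w)) t = (a * (φ u b) * φ v (i (actC (𝓣.left t) c)))
          ⊗ₜ[k] (ν₃ w * ν₂ (𝓣.right t)) := by
        intro u v w t
        simp [G, mul_assoc]
      have hGsum : ∀ (S : Finset (H₁ × H₁)) (f : H₁ × H₁ → H₁ ⊗[k] (H₁ ⊗[k] H₁)) t,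
          G (∑ s ∈ S, f s) t = ∑ s ∈ S, G (f s) t := by
        intro S f t
        simp only [G, map_sum, Finset.mul_sum, Finset.sum_mul]
      have hco := Coalgebra.sum_tmul_tmul_eq 𝓡 𝓛 𝓢
      trans ∑ t ∈ 𝓣.index, G (∑ s ∈ 𝓡.index, ∑ r ∈ (𝓢 s).index,
          𝓡.left s ⊗ₜ ((𝓢 s).left r ⊗ₜ (𝓢 s).right r)) t
      · rw [extMap_tmul, twistMap_repr _ _ a h b 𝓡, Finset.sum_mul, map_sum, LinearMap.sum_apply]
        simp only [hGsum]
        rw [Finset.sum_comm]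
        refine Finset.sum_congr rfl fun s _ => ?_
        rw [Algebra.TensorProduct.tmul_mul_tmul, mul_one, hν₁, hprod _ (𝓢 s)]
        refine Finset.sum_congr rfl fun t _ => Finset.sum_congr rfl fun r _ => ?_
        rw [hG, hν₃, hφ _ (i _)]
      · rw [← hco, twistMap_repr _ _ b h' c 𝓣, map_sum]
        refine Finset.sum_congr rfl fun t _ => ?_
        rw [extMap_tmul, twistMap_repr _ _ a h _ 𝓡, Finset.sum_mul, hGsum]
        refine Finset.sum_congr rfl fun s _ => ?_
        rw [hGsum, hφ, hθ, hB.measuring_repr _ _ _ (𝓛 s), map_sum, Finset.mul_sum,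
          TensorProduct.sum_tmul, Finset.sum_mul]
        refine Finset.sum_congr rfl fun r _ => ?_
        rw [hG, Algebra.TensorProduct.tmul_mul_tmul, mul_one, map_mul, hφ, hφ, mul_assoc]
        rfl

theorem evalMap_extMap {k A B C H₁ H₂ : Type*} [CommRing k] [Ring A] [Algebra k A]
    [Ring B] [Algebra k B] [Ring C] [Algebra k C] [Ring H₁] [Bialgebra k H₁] [Ring H₂]
    [Bialgebra k H₂] (j : B →ₐ[k] A) (i : C →ₐ[k] B)
    {actB : H₁ →ₐ[k] Module.End k B} (hB : IsModuleAlgebra actB) (actC : H₂ →ₐ[k] Module.End k C)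
    (ν₁ : H₁ →ₐc[k] H₂)
    (hc : ∀ h c, i (actC (ν₁ h) c) = actB h (i c)) (φ : H₁ →ₗ[k] B →ₗ[k] A)
    (hφ : ∀ h b, φ h b = j (actB h b)) (ψ : H₂ →ₗ[k] C →ₗ[k] A)
    (hψ : ∀ h c, ψ h c = j (i (actC h c))) (θ : H₂ →ₗ[k] C →ₗ[k] B)
    (hθ : ∀ h c, θ h c = i (actC h c))
    (ν₁' : H₁ →ₗ[k] H₂) (hν₁ : ∀ h, ν₁' h = ν₁ h)
    (x : A ⊗[k] H₁) (y : B ⊗[k] H₂) (c : C) :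
    evalMap ψ (extMap (twistMap φ ν₁' x) y) c = evalMap φ x (evalMap θ y c) := by
  induction x with
  | zero => simp [extMap_zero]
  | add x x' hx hx' => simp only [map_add, extMap_add, LinearMap.add_apply, hx, hx']
  | tmul a h =>
    induction y with
    | zero => simp
    | add y y' hy hy' => simp only [map_add, LinearMap.add_apply, hy, hy']
    | tmul b h' =>
      rw [extMap_tmul, twistMap_repr _ _ a h b (Coalgebra.Repr.arbitrary k h), evalMap_tmul,
        evalMap_tmul, Finset.sum_mul, map_sum, LinearMap.sum_apply, hφ, hθ,
        hB.measuring_repr h b _ (Coalgebra.Repr.arbitrary k h), map_sum, Finset.mul_sum]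
      refine Finset.sum_congr rfl fun s _ => ?_
      rw [Algebra.TensorProduct.tmul_mul_tmul, evalMap_tmul, mul_one, hψ, hφ, hν₁, map_mul actC,
        Module.End.mul_apply, hc, map_mul, mul_assoc]

end SmashIdentities

/-- The smash product `A # H` of an `H`-module algebra `A` with `H`: the `k`-module `A ⊗ H` with
the multiplication `(a # h)(b # h') = ∑ a h₍₁₎(b) # h₍₂₎ h'`. -/
def SmashProduct {k A H : Type*} [CommRing k] [Ring A] [Algebra k A] [Ring H] [Bialgebra k H]
    {act : H →ₐ[k] Module.End k A} (_hA : IsModuleAlgebra act) : Type _ := A ⊗[k] H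

namespace SmashProduct

variable {k A H : Type*} [CommRing k] [Ring A] [Algebra k A] [Ring H] [Bialgebra k H]
  {act : H →ₐ[k] Module.End k A}

noncomputable instance (hA : IsModuleAlgebra act) : AddCommGroup (SmashProduct hA) :=
  inferInstanceAs (AddCommGroup (A ⊗[k] H))

noncomputable instance (hA : IsModuleAlgebra act) : Module k (SmashProduct hA) :=
  inferInstanceAs (Module k (A ⊗[k] H))

/-- The multiplication of the smash product, on the underlying tensor product. -/
noncomputable def mul (act : H →ₐ[k] Module.End k A) (x y : A ⊗[k] H) : A ⊗[k] H :=
  extMap (twistMap act.toLinearMap .id x) y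

theorem mul_tmul (act : H →ₐ[k] Module.End k A) (a b : A) (h h' : H) {ι : Type*}
    (𝓡 : Coalgebra.Repr k h ι) : mul act (a ⊗ₜ h) (b ⊗ₜ h') =
      ∑ i ∈ 𝓡.index, (a * act (𝓡.left i) b) ⊗ₜ[k] (𝓡.right i * h') := by
  rw [mul, extMap_tmul, twistMap_repr _ _ a h b 𝓡, Finset.sum_mul]
  refine Finset.sum_congr rfl fun i _ => ?_
  rw [Algebra.TensorProduct.tmul_mul_tmul, mul_one]
  rfl

theorem twistMap_one {k A B H H' : Type*} [CommRing k] [Ring A] [Algebra k A]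
    [AddCommGroup B] [Module k B] [Ring H] [Bialgebra k H] [Ring H'] [Algebra k H']
    (act : H →ₗ[k] B →ₗ[k] A) (ν : H →ₐ[k] H') (b : B) :
    twistMap act ν.toLinearMap (1 : A ⊗[k] H) b = act 1 b ⊗ₜ 1 := by
  rw [Algebra.TensorProduct.one_def, twistMap_tmul, Bialgebra.comul_one,
    Algebra.TensorProduct.one_def, TensorProduct.map_tmul]
  simp

theorem twistMap_apply_one {k A B H H' : Type*} [CommRing k] [Ring A] [Algebra k A]
    [Ring B] [Algebra k B] [Ring H] [Bialgebra k H] [AddCommGroup H'] [Module k H']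
    (act : H →ₗ[k] B →ₗ[k] A) (h1 : ∀ h, act h 1 = Coalgebra.counit (R := k) h • (1 : A))
    (ν : H →ₗ[k] H') (x : A ⊗[k] H) :
    twistMap act ν x 1 = TensorProduct.map .id ν x := by
  induction x with
  | zero => simp
  | add y z hy hz => simp only [map_add, LinearMap.add_apply, hy, hz]
  | tmul a h =>
    rw [twistMap_repr _ _ a h 1 (Coalgebra.Repr.arbitrary k h)]
    simp only [h1, mul_smul_comm, mul_one, TensorProduct.smul_tmul, ← map_smul]
    rw [← TensorProduct.tmul_sum, ← map_sum, Coalgebra.sum_counit_smul]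
    rfl

theorem extMap_one {k A B H' : Type*} [CommRing k] [Ring A] [Algebra k A]
    [Ring B] [Algebra k B] [Ring H'] [Algebra k H'] (f : B →ₗ[k] A ⊗[k] H') :
    extMap f 1 = f 1 := by
  rw [Algebra.TensorProduct.one_def, extMap_tmul, ← Algebra.TensorProduct.one_def, mul_one]

theorem extMap_mk {k A H' : Type*} [CommRing k] [Ring A] [Algebra k A]
    [Ring H'] [Algebra k H'] (f : A →ₗ[k] A ⊗[k] H') (hf : ∀ b, f b = b ⊗ₜ 1) (y : A ⊗[k] H') :
    extMap f y = y := by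
  induction y with
  | zero => simp
  | add y z hy hz => simp only [map_add, hy, hz]
  | tmul b h => simp [extMap_tmul, hf]

theorem zero_mul' (act : H →ₐ[k] Module.End k A) (y : A ⊗[k] H) : mul act 0 y = 0 := by
  rw [mul, map_zero, extMap_zero]

theorem add_mul' (act : H →ₐ[k] Module.End k A) (x y z : A ⊗[k] H) :
    mul act (x + y) z = mul act x z + mul act y z := by
  rw [mul, map_add, extMap_add, mul, mul]

theorem smul_mul' (act : H →ₐ[k] Module.End k A) (c : k) (x y : A ⊗[k] H) :
    mul act (c • x) y = c • mul act x y := by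
  rw [mul, map_smul, extMap_smul, mul]

theorem one_mul' (act : H →ₐ[k] Module.End k A) (y : A ⊗[k] H) : mul act 1 y = y := by
  refine extMap_mk _ (fun b => ?_) y
  refine (twistMap_one act.toLinearMap (AlgHom.id k H) b).trans ?_
  rw [AlgHom.toLinearMap_apply, map_one]
  rfl

theorem mul_one' (hA : IsModuleAlgebra act) (x : A ⊗[k] H) : mul act x 1 = x := by
  rw [mul, extMap_one, twistMap_apply_one _ hA.map_one, TensorProduct.map_id]
  rfl

theorem mul_assoc' (hA : IsModuleAlgebra act) (x y z : A ⊗[k] H) :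
    mul act (mul act x y) z = mul act x (mul act y z) := by
  have key : ∀ c, twistMap act.toLinearMap (.id : H →ₗ[k] H) (mul act x y) c =
      extMap (twistMap act.toLinearMap .id x) (twistMap act.toLinearMap .id y c) := fun c =>
    twistMap_extMap (AlgHom.id k A) (AlgHom.id k A) hA act (BialgHom.id k H) (AlgHom.id k H)
      (fun _ _ => rfl) act.toLinearMap (fun _ _ => rfl) act.toLinearMap (fun _ _ => rfl)
      act.toLinearMap (fun _ _ => rfl) .id (fun _ => rfl) .id (fun _ => rfl) x y c
  change extMap (twistMap act.toLinearMap .id (mul act x y)) z =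
    extMap (twistMap act.toLinearMap .id x) (extMap (twistMap act.toLinearMap .id y) z)
  induction z with
  | zero => simp
  | add z z' h h' => simp only [map_add, h, h']
  | tmul c h => rw [extMap_tmul, extMap_tmul, key, extMap_mul_right]

noncomputable instance (hA : IsModuleAlgebra act) : Ring (SmashProduct hA) where
  __ := (inferInstance : AddCommGroup (SmashProduct hA))
  mul x y := mul act x y
  one := (1 : A ⊗[k] H)
  zero_mul y := zero_mul' act y
  mul_zero x := map_zero (extMap (twistMap act.toLinearMap .id x))
  left_distrib x y z := map_add (extMap (twistMap act.toLinearMap .id x)) y z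
  right_distrib x y z := add_mul' act x y z
  one_mul y := one_mul' act y
  mul_one x := mul_one' hA x
  mul_assoc x y z := mul_assoc' hA x y z

noncomputable instance (hA : IsModuleAlgebra act) : Algebra k (SmashProduct hA) :=
  Algebra.ofModule (fun c x y => smul_mul' act c x y)
    (fun c x y => map_smul (extMap (twistMap act.toLinearMap .id x)) c y)

/-- The algebra homomorphism `A # H → End(A)`, `a # h ↦ (b ↦ a * h(b))`. -/
noncomputable def toEnd (hA : IsModuleAlgebra act) : SmashProduct hA →ₐ[k] Module.End k A :=
  AlgHom.ofLinearMap (evalMap act.toLinearMap : A ⊗[k] H →ₗ[k] (A →ₗ[k] A))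
    (by
      change evalMap act.toLinearMap ((1 : A) ⊗ₜ (1 : H)) = _
      ext b
      rw [evalMap_tmul, AlgHom.toLinearMap_apply, map_one]
      simp)
    (fun x y => by
      ext c
      exact evalMap_extMap (AlgHom.id k A) (AlgHom.id k A) hA act (BialgHom.id k H)
        (fun _ _ => rfl) act.toLinearMap (fun _ _ => rfl) act.toLinearMap (fun _ _ => rfl)
        act.toLinearMap (fun _ _ => rfl) .id (fun _ => rfl) x y c)

end SmashProduct

/-- `A / k` is Hopf-Galois for the action `act` of the Hopf algebra `H`: `A` is an `H`-module
algebra, the induced algebra map `A # H → End_k(A)` is an isomorphism, and the elements on which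
`H` acts through the counit are exactly those of `k`. -/
structure IsHopfGalois {k A H : Type*} [CommRing k] [Ring A] [Algebra k A] [Ring H]
    [HopfAlgebra k H] (act : H →ₐ[k] Module.End k A) : Prop where
  isModuleAlgebra : IsModuleAlgebra act
  bijective : Function.Bijective (SmashProduct.toEnd isModuleAlgebra)
  fixed : ∀ x : A, (∀ h : H, act h x = Coalgebra.counit (R := k) h • x) ↔
    x ∈ (algebraMap k A).range

section MoreSmashIdentities

theorem twistMap_congr {k A B B' H H' : Type*} [CommRing k] [Ring A] [Algebra k A]
    [AddCommGroup B] [Module k B] [AddCommGroup B'] [Module k B'] [AddCommGroup H] [Module k H]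
    [Coalgebra k H] [AddCommGroup H'] [Module k H'] {φ : H →ₗ[k] B →ₗ[k] A}
    {φ' : H →ₗ[k] B' →ₗ[k] A} {ν ν' : H →ₗ[k] H'} {b : B} {b' : B'}
    (h : ∀ u, φ u b = φ' u b') (hν : ∀ u, ν u = ν' u) (x : A ⊗[k] H) :
    twistMap φ ν x b = twistMap φ' ν' x b' := by
  induction x with
  | zero => simp
  | add y z hy hz => simp only [map_add, LinearMap.add_apply, hy, hz]
  | tmul a u =>
    rw [twistMap_repr _ _ a u b (Coalgebra.Repr.arbitrary k u),
      twistMap_repr _ _ a u b' (Coalgebra.Repr.arbitrary k u)]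
    simp only [h, hν]

theorem evalMap_congr {k A B B' H : Type*} [CommRing k] [Ring A] [Algebra k A]
    [AddCommGroup B] [Module k B] [AddCommGroup B'] [Module k B'] [AddCommGroup H] [Module k H]
    {φ : H →ₗ[k] B →ₗ[k] A} {φ' : H →ₗ[k] B' →ₗ[k] A} {b : B} {b' : B'}
    (h : ∀ u, φ u b = φ' u b') (x : A ⊗[k] H) : evalMap φ x b = evalMap φ' x b' := by
  induction x with
  | zero => simp
  | add y z hy hz => simp only [map_add, LinearMap.add_apply, hy, hz]
  | tmul a u => rw [evalMap_tmul, evalMap_tmul, h]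

theorem twistMap_map_left {k A A' B H H' : Type*} [CommRing k] [Ring A] [Algebra k A]
    [Ring A'] [Algebra k A'] [AddCommGroup B] [Module k B] [AddCommGroup H] [Module k H]
    [Coalgebra k H] [AddCommGroup H'] [Module k H'] (j : A →ₐ[k] A') (φ : H →ₗ[k] B →ₗ[k] A)
    (φ' : H →ₗ[k] B →ₗ[k] A') (h : ∀ u b, φ' u b = j (φ u b)) (ν : H →ₗ[k] H')
    (x : A ⊗[k] H) (b : B) :
    twistMap φ' ν (TensorProduct.map j.toLinearMap .id x) b =
      TensorProduct.map j.toLinearMap .id (twistMap φ ν x b) := by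
  induction x with
  | zero => simp
  | add y z hy hz => simp only [map_add, LinearMap.add_apply, hy, hz]
  | tmul a u =>
    rw [TensorProduct.map_tmul, LinearMap.id_apply,
      twistMap_repr _ _ _ u b (Coalgebra.Repr.arbitrary k u),
      twistMap_repr _ _ _ u b (Coalgebra.Repr.arbitrary k u)]
    simp [h]

theorem evalMap_map_left {k A A' B H : Type*} [CommRing k] [Ring A] [Algebra k A]
    [Ring A'] [Algebra k A'] [AddCommGroup B] [Module k B] [AddCommGroup H] [Module k H]
    (j : A →ₐ[k] A') (φ : H →ₗ[k] B →ₗ[k] A)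
    (φ' : H →ₗ[k] B →ₗ[k] A') (h : ∀ u b, φ' u b = j (φ u b)) (x : A ⊗[k] H) (b : B) :
    evalMap φ' (TensorProduct.map j.toLinearMap .id x) b = j (evalMap φ x b) := by
  induction x with
  | zero => simp
  | add y z hy hz => simp only [map_add, LinearMap.add_apply, hy, hz]
  | tmul a u =>
    rw [TensorProduct.map_tmul, LinearMap.id_apply, evalMap_tmul, evalMap_tmul, map_mul, h]
    rfl

end MoreSmashIdentities

/-! ## Profinite Hopf algebras acting on a union of a chain of fields -/

section Union

variable {k Ω : Type*} [Field k] [Field Ω] [Algebra k Ω] {F : ℕ → IntermediateField k Ω}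

/-- The inclusion of a member of a family of fields in their compositum. -/
noncomputable def toUnion (F : ℕ → IntermediateField k Ω) (n : ℕ) :
    F n →ₐ[k] ↥(⨆ n, F n) := IntermediateField.inclusion (le_iSup F n)

theorem toUnion_inclusion {m l : ℕ} (h : F m ≤ F l) (b : F m) :
    toUnion F l (IntermediateField.inclusion h b) = toUnion F m b := rfl

theorem exists_toUnion (hF : Monotone F) (N : ℕ) (b : ↥(⨆ n, F n)) :
    ∃ m, N ≤ m ∧ ∃ b' : F m, toUnion F m b' = b := by
  have hb : (b : Ω) ∈ ((⨆ n, F n : IntermediateField k Ω) : Set Ω) := b.2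
  rw [IntermediateField.coe_iSup_of_directed hF.directed_le, Set.mem_iUnion] at hb
  obtain ⟨n, hn⟩ := hb
  exact ⟨max N n, le_max_left _ _, ⟨b, hF (le_max_right N n) hn⟩, rfl⟩

theorem exists_toUnion₂ (hF : Monotone F) (N : ℕ) (b c : ↥(⨆ n, F n)) :
    ∃ m, N ≤ m ∧ ∃ b' c' : F m, toUnion F m b' = b ∧ toUnion F m c' = c := by
  obtain ⟨m, hm, b', rfl⟩ := exists_toUnion hF N b
  obtain ⟨l, hl, c', rfl⟩ := exists_toUnion hF m c
  exact ⟨l, hm.trans hl, IntermediateField.inclusion (hF hl) b', c', rfl, rfl⟩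

theorem exists_toUnion_tensor {H : Type*} [AddCommGroup H] [Module k H] (hF : Monotone F) (N : ℕ)
    (y : ↥(⨆ n, F n) ⊗[k] H) : ∃ m, N ≤ m ∧ ∃ y' : F m ⊗[k] H,
      TensorProduct.map (toUnion F m).toLinearMap .id y' = y := by
  induction y with
  | zero => exact ⟨N, le_rfl, 0, map_zero _⟩
  | tmul b h =>
    obtain ⟨m, hm, b', rfl⟩ := exists_toUnion hF N b
    exact ⟨m, hm, b' ⊗ₜ h, rfl⟩
  | add y z hy hz =>
    obtain ⟨m, hm, y', rfl⟩ := hy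
    obtain ⟨l, hl, z', rfl⟩ := hz
    refine ⟨max m l, hm.trans (le_max_left _ _),
      TensorProduct.map
        (IntermediateField.inclusion (hF (le_max_left m l))).toLinearMap .id y' +
      TensorProduct.map
        (IntermediateField.inclusion (hF (le_max_right m l))).toLinearMap .id z', ?_⟩
    rw [map_add, ← LinearMap.comp_apply, ← LinearMap.comp_apply, ← TensorProduct.map_comp,
      ← TensorProduct.map_comp]
    rfl

theorem glue_aux {V : Type*} [AddCommGroup V] [Module k V] (hF : Monotone F) (N : ℕ)
    (f : ∀ m, N ≤ m → (F m →ₗ[k] V))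
    (hf : ∀ m l (hm : N ≤ m) (hml : m ≤ l) (b : F m),
      f l (hm.trans hml) (IntermediateField.inclusion (hF hml) b) = f m hm b)
    {l m : ℕ} (hl : N ≤ l) (hm : N ≤ m) (c : F l) (b : F m) (h : toUnion F l c = toUnion F m b) :
    f l hl c = f m hm b := by
  rw [← hf l (max l m) hl (le_max_left _ _) c, ← hf m (max l m) hm (le_max_right _ _) b]
  congr 1
  apply Subtype.ext
  exact congrArg (fun z : ↥(⨆ n, F n) => (z : Ω)) h

/-- Compatible linear maps on the members `F m`, `m ≥ N`, of a chain of fields define a linear map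
on their union. -/
noncomputable def glue {V : Type*} [AddCommGroup V] [Module k V] (hF : Monotone F) (N : ℕ)
    (f : ∀ m, N ≤ m → (F m →ₗ[k] V))
    (hf : ∀ m l (hm : N ≤ m) (hml : m ≤ l) (b : F m),
      f l (hm.trans hml) (IntermediateField.inclusion (hF hml) b) = f m hm b) :
    ↥(⨆ n, F n) →ₗ[k] V :=
  have key : ∀ (m : ℕ) (hm : N ≤ m) (b : F m),
      f (exists_toUnion hF N (toUnion F m b)).choose
        (exists_toUnion hF N (toUnion F m b)).choose_spec.1
        (exists_toUnion hF N (toUnion F m b)).choose_spec.2.choose = f m hm b :=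
    fun m hm b => glue_aux hF N f hf _ hm _ b
      (exists_toUnion hF N (toUnion F m b)).choose_spec.2.choose_spec
  { toFun := fun b => f (exists_toUnion hF N b).choose (exists_toUnion hF N b).choose_spec.1
      (exists_toUnion hF N b).choose_spec.2.choose
    map_add' := fun b c => by
      obtain ⟨m, hm, b', c', rfl, rfl⟩ := exists_toUnion₂ hF N b c
      rw [← map_add, key m hm, key m hm, key m hm, map_add]
    map_smul' := fun r b => by
      obtain ⟨m, hm, b', rfl⟩ := exists_toUnion hF N b
      rw [← map_smul, key m hm, key m hm, map_smul]
      rfl }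

theorem glue_toUnion {V : Type*} [AddCommGroup V] [Module k V] (hF : Monotone F) (N : ℕ)
    (f : ∀ m, N ≤ m → (F m →ₗ[k] V))
    (hf : ∀ m l (hm : N ≤ m) (hml : m ≤ l) (b : F m),
      f l (hm.trans hml) (IntermediateField.inclusion (hF hml) b) = f m hm b)
    (m : ℕ) (hm : N ≤ m) (b : F m) : glue hF N f hf (toUnion F m b) = f m hm b :=
  glue_aux hF N f hf _ hm _ b (exists_toUnion hF N (toUnion F m b)).choose_spec.2.choose_spec

end Union

/-- An inverse system `ν : H j → H i` (`i ≤ j`) of Hopf algebras over `k` that acts on an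
increasing chain of fields `F 0 ⊆ F 1 ⊆ ⋯`: each `F n` is an `H n`-module algebra, and `H j` acts
on `F i ⊆ F j` through `ν : H j → H i`. -/
structure ProfiniteHopfAction (k : Type*) {Ω : Type*} [Field k] [Field Ω] [Algebra k Ω]
    (F : ℕ → IntermediateField k Ω) (H : ℕ → Type*) [∀ n, Ring (H n)]
    [∀ n, HopfAlgebra k (H n)] where
  mono : Monotone F
  ν : ∀ {i j : ℕ}, i ≤ j → (H j →ₐc[k] H i)
  ν_refl : ∀ (i : ℕ) (h : H i), ν (le_refl i) h = h
  ν_trans : ∀ {i j l : ℕ} (hij : i ≤ j) (hjl : j ≤ l) (h : H l),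
    ν hij (ν hjl h) = ν (hij.trans hjl) h
  act : ∀ n, H n →ₐ[k] Module.End k (F n)
  isModuleAlgebra : ∀ n, IsModuleAlgebra (act n)
  act_ν : ∀ {i j : ℕ} (hij : i ≤ j) (h : H j) (b : F i),
    act j h (IntermediateField.inclusion (mono hij) b) =
      IntermediateField.inclusion (mono hij) (act i (ν hij h) b)

namespace ProfiniteHopfAction

variable {k Ω : Type*} [Field k] [Field Ω] [Algebra k Ω]
  {F : ℕ → IntermediateField k Ω} {H : ℕ → Type*} [∀ n, Ring (H n)] [∀ n, HopfAlgebra k (H n)]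

/-- The transition maps as linear maps. -/
def νL (P : ProfiniteHopfAction k F H) {i j : ℕ} (h : i ≤ j) : H j →ₗ[k] H i :=
  (P.ν h).toCoalgHom.toLinearMap

/-- The transition maps as algebra homomorphisms. -/
def νA (P : ProfiniteHopfAction k F H) {i j : ℕ} (h : i ≤ j) : H j →ₐ[k] H i := (P.ν h)

/-- The action of `H n` on `F n`, with values in the larger field `F m`, `n ≤ m`. -/
noncomputable def actUp (P : ProfiniteHopfAction k F H) {n m : ℕ} (h : n ≤ m) :
    H n →ₗ[k] F n →ₗ[k] F m :=
  LinearMap.llcomp k (F n) (F n) (F m) (IntermediateField.inclusion (P.mono h)).toLinearMap ∘ₗ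
    (P.act n).toLinearMap

/-- The action of `H n` on `F n`, with values in the union of all the fields. -/
noncomputable def actInto (P : ProfiniteHopfAction k F H) (n : ℕ) :
    H n →ₗ[k] F n →ₗ[k] ↥(⨆ n, F n) :=
  LinearMap.llcomp k (F n) (F n) ↥(⨆ n, F n) (toUnion F n).toLinearMap ∘ₗ (P.act n).toLinearMap

theorem actInto_apply (P : ProfiniteHopfAction k F H) (n : ℕ) (h : H n) (b : F n) :
    P.actInto n h b = toUnion F n (P.act n h b) := rfl

/-- The profinite Hopf algebra `H_∞ = lim H n`, as an algebra. Its comultiplication is the family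
of the comultiplications of the `H n` and takes values in `lim (H n ⊗ H n)`. -/
def limit (P : ProfiniteHopfAction k F H) : Subalgebra k (∀ n, H n) where
  carrier := {h | ∀ (i j : ℕ) (hij : i ≤ j), P.ν hij (h j) = h i}
  mul_mem' := fun {a b} ha hb i j hij => by
    rw [Pi.mul_apply, map_mul, ha i j hij, hb i j hij, Pi.mul_apply]
  add_mem' := fun {a b} ha hb i j hij => by
    rw [Pi.add_apply, map_add, ha i j hij, hb i j hij, Pi.add_apply]
  algebraMap_mem' := fun r i j hij => by
    rw [Pi.algebraMap_apply, Pi.algebraMap_apply, AlgHomClass.commutes]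

/-- The counit of `H_∞`, which is the counit of `H n` on the `n`-th component for each `n`. -/
def counit (P : ProfiniteHopfAction k F H) : P.limit →ₐ[k] k :=
  (Bialgebra.counitAlgHom k (H 0)).comp ((Pi.evalAlgHom k H 0).comp P.limit.val)

theorem counit_eq (P : ProfiniteHopfAction k F H) (h : P.limit) (n : ℕ) :
    P.counit h = Coalgebra.counit (R := k) ((h : ∀ n, H n) n) := by
  have := h.2 0 n (Nat.zero_le n)
  change Coalgebra.counit (R := k) ((h : ∀ n, H n) 0) = _
  rw [← this]
  exact CoalgHomClass.counit_comp_apply (P.ν (Nat.zero_le n)) _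

theorem actInto_compat (P : ProfiniteHopfAction k F H) (h : P.limit) (m l : ℕ) (_ : 0 ≤ m)
    (hml : m ≤ l) (b : F m) :
    P.actInto l ((h : ∀ n, H n) l) (IntermediateField.inclusion (P.mono hml) b) =
      P.actInto m ((h : ∀ n, H n) m) b := by
  rw [actInto_apply, actInto_apply, P.act_ν hml, toUnion_inclusion, h.2 m l hml]

/-- The action of an element of `H_∞` on the union of the fields: `h` acts on `F n` as its
component `h n`. -/
noncomputable def actFun (P : ProfiniteHopfAction k F H) (h : P.limit) :
    Module.End k ↥(⨆ n, F n) :=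
  glue P.mono 0 (fun m _ => P.actInto m ((h : ∀ n, H n) m)) (P.actInto_compat h)

theorem actFun_toUnion (P : ProfiniteHopfAction k F H) (h : P.limit) (m : ℕ) (b : F m) :
    P.actFun h (toUnion F m b) = toUnion F m (P.act m ((h : ∀ n, H n) m) b) :=
  glue_toUnion P.mono 0 _ (P.actInto_compat h) m (Nat.zero_le m) b

/-- The action of `H_∞` on the union of the fields. -/
noncomputable def actLimit (P : ProfiniteHopfAction k F H) :
    P.limit →ₐ[k] Module.End k ↥(⨆ n, F n) :=
  AlgHom.ofLinearMap
    { toFun := P.actFun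
      map_add' := fun h h' => by
        refine LinearMap.ext fun b => ?_
        obtain ⟨m, -, b, rfl⟩ := exists_toUnion P.mono 0 b
        rw [LinearMap.add_apply, actFun_toUnion, actFun_toUnion, actFun_toUnion, ← map_add,
          ← LinearMap.add_apply, ← map_add]
        rfl
      map_smul' := fun r h => by
        refine LinearMap.ext fun b => ?_
        obtain ⟨m, -, b, rfl⟩ := exists_toUnion P.mono 0 b
        rw [RingHom.id_apply, LinearMap.smul_apply, actFun_toUnion, actFun_toUnion, ← map_smul,
          ← LinearMap.smul_apply, ← map_smul]
        rfl }
    (by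
      refine LinearMap.ext fun b => ?_
      obtain ⟨m, -, b, rfl⟩ := exists_toUnion P.mono 0 b
      refine (P.actFun_toUnion 1 m b).trans ?_
      change toUnion F m (P.act m 1 b) = _
      rw [map_one]
      rfl)
    (fun h h' => by
      refine LinearMap.ext fun b => ?_
      obtain ⟨m, -, b, rfl⟩ := exists_toUnion P.mono 0 b
      change P.actFun (h * h') _ = P.actFun h (P.actFun h' _)
      rw [actFun_toUnion, actFun_toUnion, actFun_toUnion]
      change toUnion F m (P.act m (_ * _) b) = _
      rw [map_mul]
      rfl)

/-- The completed tensor product `K ⊗^ H_∞ = lim (K ⊗ H n)`, where `K` is the union of the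
fields. -/
noncomputable def completedTensor (P : ProfiniteHopfAction k F H) :
    Submodule k (∀ n, ↥(⨆ n, F n) ⊗[k] H n) where
  carrier := {x | ∀ (i j : ℕ) (hij : i ≤ j),
    TensorProduct.map LinearMap.id (P.νL hij) (x j) = x i}
  zero_mem' := fun i j hij => map_zero _
  add_mem' := fun {a b} ha hb i j hij => by
    rw [Pi.add_apply, map_add, ha i j hij, hb i j hij, Pi.add_apply]
  smul_mem' := fun r a ha i j hij => by
    rw [Pi.smul_apply, map_smul, ha i j hij, Pi.smul_apply]

/-- For `x ∈ K ⊗^ H_∞` and `b ∈ K`, the `n`-th component of the product `x (b # 1)`, i.e. of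
`∑ a h₍₁₎(b) # h₍₂₎` for `x = a # h`. If `b ∈ F m` with `m ≥ n` then `H_∞` acts on `b` through
`H m`, and this is `∑ a h₍₁₎(b) ⊗ ν(h₍₂₎) ∈ K ⊗ H n` computed from the component `x m ∈ K ⊗ H m`. -/
noncomputable def twist (P : ProfiniteHopfAction k F H) (x : P.completedTensor) (n : ℕ) :
    ↥(⨆ n, F n) →ₗ[k] ↥(⨆ n, F n) ⊗[k] H n :=
  glue P.mono n
    (fun m hm => twistMap (P.actInto m) (P.νL hm)
      ((x : ∀ n, ↥(⨆ n, F n) ⊗[k] H n) m))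
    (fun m l hm hml b => by
      rw [← x.2 m l hml]
      refine Eq.trans ?_ (twistMap_map (P.actInto m) (P.νL hm) (P.ν hml).toCoalgHom _ b).symm
      refine twistMap_congr (fun u => ?_) (fun u => ?_) _
      · rw [actInto_apply, P.act_ν, toUnion_inclusion]
        rfl
      · exact (P.ν_trans hm hml u).symm)

theorem twist_toUnion (P : ProfiniteHopfAction k F H) (x : P.completedTensor) {n m : ℕ}
    (hm : n ≤ m) (b : F m) : P.twist x n (toUnion F m b) =
      twistMap (P.actInto m) (P.νL hm) ((x : ∀ n, ↥(⨆ n, F n) ⊗[k] H n) m) b :=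
  glue_toUnion P.mono n _ _ m hm b

theorem map_twist (P : ProfiniteHopfAction k F H) (x : P.completedTensor) {i j : ℕ}
    (hij : i ≤ j) (b : ↥(⨆ n, F n)) :
    TensorProduct.map LinearMap.id (P.νL hij) (P.twist x j b) = P.twist x i b := by
  obtain ⟨m, hm, b, rfl⟩ := exists_toUnion P.mono j b
  rw [twist_toUnion P x hm, twist_toUnion P x (hij.trans hm), map_twistMap]
  exact twistMap_congr (fun u => rfl) (fun u => P.ν_trans hij hm u) _

/-- The multiplication `(a # h)(b # h') = ∑ a h₍₁₎(b) # h₍₂₎ h'` of `K #^ H_∞`. -/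
noncomputable def mul (P : ProfiniteHopfAction k F H) (x y : P.completedTensor) :
    P.completedTensor :=
  ⟨fun n => extMap (P.twist x n) ((y : ∀ n, ↥(⨆ n, F n) ⊗[k] H n) n), fun i j hij => by
    refine (map_extMap (P.νA hij) (P.twist x j) _).trans ?_
    have h1 : TensorProduct.map LinearMap.id (P.νA hij).toLinearMap ∘ₗ P.twist x j =
        P.twist x i := LinearMap.ext fun b => P.map_twist x hij b
    rw [h1]
    exact congrArg _ (y.2 i j hij)⟩

theorem mul_apply (P : ProfiniteHopfAction k F H) (x y : P.completedTensor) (n : ℕ) :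
    (P.mul x y : ∀ n, ↥(⨆ n, F n) ⊗[k] H n) n =
      extMap (P.twist x n) ((y : ∀ n, ↥(⨆ n, F n) ⊗[k] H n) n) := rfl

theorem twist_mul (P : ProfiniteHopfAction k F H) (x y : P.completedTensor) (n : ℕ)
    (c : ↥(⨆ n, F n)) : P.twist (P.mul x y) n c = extMap (P.twist x n) (P.twist y n c) := by
  obtain ⟨m, hm, c, rfl⟩ := exists_toUnion P.mono n c
  obtain ⟨l, hl, y', hy'⟩ := exists_toUnion_tensor P.mono m
    ((y : ∀ n, ↥(⨆ n, F n) ⊗[k] H n) m)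
  have hx : ∀ (q : ℕ) (hq : q ≤ l), P.twist x q ∘ₗ (toUnion F l).toLinearMap =
      twistMap (P.actInto l) (P.νL hq) ((x : ∀ n, ↥(⨆ n, F n) ⊗[k] H n) l) :=
    fun q hq => LinearMap.ext fun b => twist_toUnion P x hq b
  rw [twist_toUnion P _ hm, twist_toUnion P _ hm, mul_apply, ← hy', extMap_comp_map,
    twistMap_map_left (toUnion F l) (P.actUp hl) (P.actInto m) (fun u b => rfl), extMap_comp_map,
    hx m hl, hx n (hm.trans hl)]
  exact twistMap_extMap (toUnion F l) (IntermediateField.inclusion (P.mono hl))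
    (P.isModuleAlgebra l) (P.act m) (P.ν hl) (P.νA hm) (fun h c => (P.act_ν hl h c).symm)
    (P.actInto l) (fun _ _ => rfl) (P.actInto m) (fun _ _ => rfl) (P.actUp hl) (fun _ _ => rfl)
    (P.νL (hm.trans hl)) (fun h => (P.ν_trans hm hl h).symm) (P.νL hl) (fun _ => rfl) _ y' c

/-- The unit `1 # 1` of `K #^ H_∞`. -/
noncomputable def one (P : ProfiniteHopfAction k F H) : P.completedTensor :=
  ⟨fun n => 1, fun i j hij => by
    change (1 : ↥(⨆ n, F n)) ⊗ₜ[k] (P.νA hij (1 : H j)) = _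
    rw [map_one]
    rfl⟩

theorem twist_one (P : ProfiniteHopfAction k F H) (n : ℕ) (b : ↥(⨆ n, F n)) :
    P.twist P.one n b = b ⊗ₜ 1 := by
  obtain ⟨m, hm, b, rfl⟩ := exists_toUnion P.mono n b
  rw [twist_toUnion P _ hm]
  refine (SmashProduct.twistMap_one (P.actInto m) (P.νA hm) b).trans ?_
  rw [actInto_apply, map_one]
  rfl

theorem mul_one' (P : ProfiniteHopfAction k F H) (x : P.completedTensor) : P.mul x P.one = x := by
  apply Subtype.ext
  funext n
  refine (SmashProduct.extMap_one (P.twist x n)).trans ?_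
  rw [← map_one (toUnion F n), twist_toUnion P x le_rfl, SmashProduct.twistMap_apply_one]
  · exact x.2 n n le_rfl
  · intro h
    rw [actInto_apply, (P.isModuleAlgebra n).map_one, map_smul, map_one]

theorem one_mul' (P : ProfiniteHopfAction k F H) (x : P.completedTensor) : P.mul P.one x = x := by
  apply Subtype.ext
  funext n
  exact SmashProduct.extMap_mk _ (P.twist_one n) _

theorem mul_assoc' (P : ProfiniteHopfAction k F H) (x y z : P.completedTensor) :
    P.mul (P.mul x y) z = P.mul x (P.mul y z) := by
  apply Subtype.ext
  funext n
  rw [mul_apply, mul_apply, mul_apply]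
  generalize (z : ∀ n, ↥(⨆ n, F n) ⊗[k] H n) n = t
  induction t with
  | zero => simp
  | add z z' h h' => simp only [map_add, h, h']
  | tmul c h => rw [extMap_tmul, extMap_tmul, twist_mul, extMap_mul_right]

theorem twist_add (P : ProfiniteHopfAction k F H) (x y : P.completedTensor) (n : ℕ) :
    P.twist (x + y) n = P.twist x n + P.twist y n := by
  refine LinearMap.ext fun b => ?_
  obtain ⟨m, hm, b, rfl⟩ := exists_toUnion P.mono n b
  rw [LinearMap.add_apply, twist_toUnion P _ hm, twist_toUnion P _ hm, twist_toUnion P _ hm,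
    Submodule.coe_add, Pi.add_apply, map_add, LinearMap.add_apply]

theorem twist_smul (P : ProfiniteHopfAction k F H) (r : k) (x : P.completedTensor) (n : ℕ) :
    P.twist (r • x) n = r • P.twist x n := by
  refine LinearMap.ext fun b => ?_
  obtain ⟨m, hm, b, rfl⟩ := exists_toUnion P.mono n b
  rw [LinearMap.smul_apply, twist_toUnion P _ hm, twist_toUnion P _ hm,
    Submodule.coe_smul, Pi.smul_apply, map_smul, LinearMap.smul_apply]

theorem add_mul' (P : ProfiniteHopfAction k F H) (x y z : P.completedTensor) :
    P.mul (x + y) z = P.mul x z + P.mul y z := by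
  apply Subtype.ext
  funext n
  rw [mul_apply, twist_add, extMap_add]
  rfl

theorem mul_add' (P : ProfiniteHopfAction k F H) (x y z : P.completedTensor) :
    P.mul x (y + z) = P.mul x y + P.mul x z := by
  apply Subtype.ext
  funext n
  exact map_add (extMap (P.twist x n)) _ _

theorem smul_mul' (P : ProfiniteHopfAction k F H) (r : k) (x y : P.completedTensor) :
    P.mul (r • x) y = r • P.mul x y := by
  apply Subtype.ext
  funext n
  rw [mul_apply, twist_smul, extMap_smul]
  rfl

theorem mul_smul' (P : ProfiniteHopfAction k F H) (r : k) (x y : P.completedTensor) :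
    P.mul x (r • y) = r • P.mul x y := by
  apply Subtype.ext
  funext n
  exact map_smul (extMap (P.twist x n)) r _

/-- The (completed) smash product `K # H_∞ = lim (K ⊗ H n)` of the union `K` of the fields with the
profinite Hopf algebra `H_∞ = lim H n`, with the multiplication
`(a # h)(b # h') = ∑ a h₍₁₎(b) # h₍₂₎ h'`. -/
def Smash (P : ProfiniteHopfAction k F H) : Type _ := P.completedTensor

noncomputable instance (P : ProfiniteHopfAction k F H) : AddCommGroup P.Smash :=
  inferInstanceAs (AddCommGroup P.completedTensor)

noncomputable instance (P : ProfiniteHopfAction k F H) : Module k P.Smash :=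
  inferInstanceAs (Module k P.completedTensor)

noncomputable instance (P : ProfiniteHopfAction k F H) : Ring P.Smash where
  __ := (inferInstance : AddCommGroup P.Smash)
  mul := P.mul
  one := P.one
  zero_mul y := by
    have h := P.smul_mul' 0 0 y
    rw [zero_smul, zero_smul] at h
    exact h
  mul_zero x := by
    have h := P.mul_smul' 0 x 0
    rw [zero_smul, zero_smul] at h
    exact h
  left_distrib := P.mul_add'
  right_distrib := P.add_mul'
  one_mul := P.one_mul'
  mul_one := P.mul_one'
  mul_assoc := P.mul_assoc'

noncomputable instance (P : ProfiniteHopfAction k F H) : Algebra k P.Smash :=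
  Algebra.ofModule P.smul_mul' P.mul_smul'

/-- The component in `K ⊗ H n` of an element of `K # H_∞`. -/
def Smash.proj {P : ProfiniteHopfAction k F H} (x : P.Smash) (n : ℕ) :
    ↥(⨆ n, F n) ⊗[k] H n := x.1 n

/-- The element `a # h` of `K # H_∞`. -/
noncomputable def smash (P : ProfiniteHopfAction k F H) (a : ↥(⨆ n, F n)) (h : P.limit) :
    P.Smash :=
  ⟨fun n => a ⊗ₜ (h : ∀ n, H n) n, fun i j hij =>
    congrArg (fun t => a ⊗ₜ[k] t) (h.2 i j hij)⟩

theorem evalMap_compat (P : ProfiniteHopfAction k F H) (x : P.completedTensor) (m l : ℕ)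
    (_ : 0 ≤ m) (hml : m ≤ l) (b : F m) :
    evalMap (P.actInto l) ((x : ∀ n, ↥(⨆ n, F n) ⊗[k] H n) l)
      (IntermediateField.inclusion (P.mono hml) b) =
        evalMap (P.actInto m) ((x : ∀ n, ↥(⨆ n, F n) ⊗[k] H n) m) b := by
  rw [← x.2 m l hml, evalMap_map]
  refine evalMap_congr (fun u => ?_) _
  rw [actInto_apply, P.act_ν hml, toUnion_inclusion]
  rfl

/-- The endomorphism of the union `K` of the fields defined by an element `x` of `K ⊗^ H_∞`:
on `F m` it is given by the component `x m ∈ K ⊗ H m`, through `a ⊗ h ↦ (b ↦ a * h(b))`. -/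
noncomputable def endFun (P : ProfiniteHopfAction k F H) (x : P.completedTensor) :
    Module.End k ↥(⨆ n, F n) :=
  glue P.mono 0 (fun m _ => evalMap (P.actInto m) ((x : ∀ n, ↥(⨆ n, F n) ⊗[k] H n) m))
    (P.evalMap_compat x)

theorem endFun_toUnion (P : ProfiniteHopfAction k F H) (x : P.completedTensor) (m : ℕ) (b : F m) :
    P.endFun x (toUnion F m b) =
      evalMap (P.actInto m) ((x : ∀ n, ↥(⨆ n, F n) ⊗[k] H n) m) b :=
  glue_toUnion P.mono 0 _ (P.evalMap_compat x) m (Nat.zero_le m) b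

theorem endFun_mul (P : ProfiniteHopfAction k F H) (x y : P.completedTensor)
    (c : ↥(⨆ n, F n)) : P.endFun (P.mul x y) c = P.endFun x (P.endFun y c) := by
  obtain ⟨m, -, c, rfl⟩ := exists_toUnion P.mono 0 c
  obtain ⟨l, hl, y', hy'⟩ := exists_toUnion_tensor P.mono m
    ((y : ∀ n, ↥(⨆ n, F n) ⊗[k] H n) m)
  have hx : P.twist x m ∘ₗ (toUnion F l).toLinearMap =
      twistMap (P.actInto l) (P.νL hl) ((x : ∀ n, ↥(⨆ n, F n) ⊗[k] H n) l) :=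
    LinearMap.ext fun b => twist_toUnion P x hl b
  rw [endFun_toUnion, endFun_toUnion, mul_apply, ← hy', extMap_comp_map, hx,
    evalMap_map_left (toUnion F l) (P.actUp hl) (P.actInto m) (fun u b => rfl), endFun_toUnion]
  exact evalMap_extMap (toUnion F l) (IntermediateField.inclusion (P.mono hl))
    (P.isModuleAlgebra l) (P.act m) (P.ν hl) (fun h c => (P.act_ν hl h c).symm)
    (P.actInto l) (fun _ _ => rfl) (P.actInto m) (fun _ _ => rfl) (P.actUp hl)
    (fun _ _ => rfl) (P.νL hl) (fun _ => rfl) _ y' c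

theorem endFun_one (P : ProfiniteHopfAction k F H) : P.endFun P.one = 1 := by
  refine LinearMap.ext fun b => ?_
  obtain ⟨m, -, b, rfl⟩ := exists_toUnion P.mono 0 b
  rw [endFun_toUnion]
  change evalMap (P.actInto m) ((1 : ↥(⨆ n, F n)) ⊗ₜ (1 : H m)) b = _
  rw [evalMap_tmul, actInto_apply, map_one, one_mul]
  rfl

/-- `endFun` as a linear map. -/
noncomputable def endLinear (P : ProfiniteHopfAction k F H) :
    P.completedTensor →ₗ[k] Module.End k ↥(⨆ n, F n) where
  toFun := P.endFun
  map_add' x y := by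
    refine LinearMap.ext fun b => ?_
    obtain ⟨m, -, b, rfl⟩ := exists_toUnion P.mono 0 b
    rw [LinearMap.add_apply, endFun_toUnion, endFun_toUnion, endFun_toUnion,
      Submodule.coe_add, Pi.add_apply, map_add, LinearMap.add_apply]
  map_smul' r x := by
    refine LinearMap.ext fun b => ?_
    obtain ⟨m, -, b, rfl⟩ := exists_toUnion P.mono 0 b
    rw [RingHom.id_apply, LinearMap.smul_apply, endFun_toUnion, endFun_toUnion,
      Submodule.coe_smul, Pi.smul_apply, map_smul, LinearMap.smul_apply]

/-- The algebra homomorphism `K # H_∞ → End(K)` induced by the action of `H_∞` on `K`. -/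
noncomputable def toEnd (P : ProfiniteHopfAction k F H) :
    P.Smash →ₐ[k] Module.End k ↥(⨆ n, F n) :=
  AlgHom.ofLinearMap (P.endLinear : P.Smash →ₗ[k] _) P.endFun_one
    (fun x y => LinearMap.ext fun c => P.endFun_mul x y c)

/-- The algebra of `k`-linear endomorphisms of the union of the fields. -/
abbrev EndUnion (_P : ProfiniteHopfAction k F H) : Type _ := Module.End k ↥(⨆ n, F n)

/-- The map `F m ⊗ H n → Hom(F n, F m)`, `a ⊗ h ↦ (b ↦ a * h(b))`, for `n ≤ m`. -/
noncomputable def evalUp (P : ProfiniteHopfAction k F H) {n m : ℕ} (h : n ≤ m) :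
    F m ⊗[k] H n →ₗ[k] (F n →ₗ[k] F m) := evalMap (P.actUp h)

/-- The map `K ⊗ H n → Hom(F n, K)`, `a ⊗ h ↦ (b ↦ a * h(b))`, for the union `K` of the fields. -/
noncomputable def evalInto (P : ProfiniteHopfAction k F H) (n : ℕ) :
    ↥(⨆ n, F n) ⊗[k] H n →ₗ[k] (F n →ₗ[k] ↥(⨆ n, F n)) := evalMap (P.actInto n)

/-- `Hom(F n, K)`, for the union `K` of the fields, is the direct limit (the union) of the spaces
`Hom(F n, F m)`, `m ≥ n`. -/
def HomIsDirectLimit (_P : ProfiniteHopfAction k F H) (n : ℕ) : Prop :=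
  ∀ f : F n →ₗ[k] ↥(⨆ n, F n), ∃ m, n ≤ m ∧ ∃ g : F n →ₗ[k] F m, ∀ b, f b = toUnion F m (g b)

/-- `F n` is Hopf-Galois over `k` for the action of the Hopf algebra `H n`. -/
def IsHopfGaloisAt (P : ProfiniteHopfAction k F H) (n : ℕ) : Prop := _root_.IsHopfGalois (P.act n)

/-- The union `K` of the fields is Hopf-Galois over `k` for the profinite Hopf algebra `H_∞`:
the action measures (for the comultiplication `h ↦ (Δ(h n))ₙ` of `H_∞`), the induced algebra map
`K # H_∞ → End_k(K)` is an isomorphism, and the elements on which `H_∞` acts through its counit are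
exactly those of `k`. -/
structure IsHopfGalois (P : ProfiniteHopfAction k F H) : Prop where
  measuring : ∀ (h : P.limit) (n : ℕ) (a b : F n),
    P.actLimit h (toUnion F n a * toUnion F n b) =
      LinearMap.mul' k ↥(⨆ n, F n) (TensorProduct.map ((P.actInto n).flip a)
        ((P.actInto n).flip b) (Coalgebra.comul (R := k) ((h : ∀ n, H n) n)))
  bijective : Function.Bijective P.toEnd
  fixed : ∀ x : ↥(⨆ n, F n), (∀ h : P.limit, P.actLimit h x = P.counit h • x) ↔
    x ∈ (algebraMap k ↥(⨆ n, F n)).range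

end ProfiniteHopfAction

/-! ## The radical tower -/

/-- Compatible choices of `p ^ n`-th roots `w n` of the element `a` of `k` and of primitive
`p ^ n`-th roots of unity `ζ n`, in a field `Ω` containing `k`. -/
structure RadicalTower (p : ℕ) {k : Type*} [Field k] (a : k) (Ω : Type*) [Field Ω]
    [Algebra k Ω] where
  w : ℕ → Ω
  ζ : ℕ → Ω
  w_zero : w 0 = algebraMap k Ω a
  w_succ : ∀ n, w (n + 1) ^ p = w n
  ζ_prim : ∀ n, IsPrimitiveRoot (ζ n) (p ^ n)
  ζ_succ : ∀ n, ζ (n + 1) ^ p = ζ n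

namespace RadicalTower

variable {p : ℕ} {k : Type*} [Field k] {a : k} {Ω : Type*} [Field Ω] [Algebra k Ω]

/-- The field `k(w n)`. -/
def K (T : RadicalTower p a Ω) (n : ℕ) : IntermediateField k Ω :=
  IntermediateField.adjoin k {T.w n}

/-- The field `k(ζ n)`. -/
def E (T : RadicalTower p a Ω) (n : ℕ) : IntermediateField k Ω :=
  IntermediateField.adjoin k {T.ζ n}

/-- The field `k(ζ n, w n)`. -/
def L (T : RadicalTower p a Ω) (n : ℕ) : IntermediateField k Ω :=
  IntermediateField.adjoin k {T.ζ n, T.w n}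

theorem w_mem (T : RadicalTower p a Ω) (n : ℕ) : T.w n ∈ T.L n :=
  IntermediateField.subset_adjoin _ _ (by simp)

theorem ζ_mem (T : RadicalTower p a Ω) (n : ℕ) : T.ζ n ∈ T.L n :=
  IntermediateField.subset_adjoin _ _ (by simp)

theorem K_le_L (T : RadicalTower p a Ω) (n : ℕ) : T.K n ≤ T.L n :=
  IntermediateField.adjoin.mono _ _ _ (by simp)

theorem E_le_L (T : RadicalTower p a Ω) (n : ℕ) : T.E n ≤ T.L n :=
  IntermediateField.adjoin.mono _ _ _ (by simp)

theorem w_pow (T : RadicalTower p a Ω) (n : ℕ) : T.w n ^ p ^ n = algebraMap k Ω a := by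
  induction n with
  | zero => simpa using T.w_zero
  | succ n ih => rw [pow_succ', pow_mul, T.w_succ, ih]

theorem L_mono (T : RadicalTower p a Ω) : Monotone T.L := by
  refine monotone_nat_of_le_succ fun n => ?_
  refine IntermediateField.adjoin_le_iff.2 ?_
  rintro x (rfl | rfl)
  · change T.ζ n ∈ T.L (n + 1)
    rw [← T.ζ_succ]
    exact pow_mem (T.ζ_mem _) _
  · change T.w n ∈ T.L (n + 1)
    rw [← T.w_succ]
    exact pow_mem (T.w_mem _) _

/-- `ζ n` as an element of `k(ζ n, w n)`. -/
def ζL (T : RadicalTower p a Ω) (n : ℕ) : T.L n := ⟨T.ζ n, T.ζ_mem n⟩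

/-- `w n` as an element of `k(ζ n, w n)`. -/
def wL (T : RadicalTower p a Ω) (n : ℕ) : T.L n := ⟨T.w n, T.w_mem n⟩

theorem adjoin_ζL_wL (T : RadicalTower p a Ω) (n : ℕ) :
    IntermediateField.adjoin k {T.ζL n, T.wL n} = ⊤ := by
  apply IntermediateField.map_injective (T.L n).val
  rw [IntermediateField.adjoin_map, Set.image_pair, ← AlgHom.fieldRange_eq_map,
    IntermediateField.fieldRange_val]
  rfl

theorem ζL_prim (T : RadicalTower p a Ω) (n : ℕ) : IsPrimitiveRoot (T.ζL n) (p ^ n) :=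
  IsPrimitiveRoot.of_map_of_injective (f := (T.L n).val) (T.ζ_prim n) Subtype.val_injective

open Polynomial in
theorem normal_L [hp : Fact p.Prime] (T : RadicalTower p a Ω) (n : ℕ) : Normal k (T.L n) := by
  have : NeZero (p ^ n) := ⟨pow_ne_zero _ hp.out.ne_zero⟩
  have hs : ∀ b : k, ∀ α : T.L n, α ^ p ^ n = algebraMap k (T.L n) b →
      ((X ^ p ^ n - C b : k[X]).map (algebraMap k (T.L n))).Splits := by
    intro b α hα
    rw [Polynomial.map_sub, Polynomial.map_pow, map_X, map_C]
    exact X_pow_sub_C_splits_of_isPrimitiveRoot (T.ζL_prim n) hα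
  have hζ : T.ζL n ^ p ^ n = algebraMap k (T.L n) 1 := by
    rw [map_one]
    exact (T.ζL_prim n).pow_eq_one
  have hw : T.wL n ^ p ^ n = algebraMap k (T.L n) a := Subtype.ext (T.w_pow n)
  have hne : ∀ b : k, (X ^ p ^ n - C b : k[X]) ≠ 0 := fun b =>
    X_pow_sub_C_ne_zero (Nat.pos_of_ne_zero (NeZero.ne _)) b
  have : IsSplittingField k (T.L n) ((X ^ p ^ n - C 1) * (X ^ p ^ n - C a) : k[X]) := by
    refine isSplittingField_iff_intermediateField.2 ⟨?_, ?_⟩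
    · rw [Polynomial.map_mul]
      exact (hs 1 _ hζ).mul (hs a _ hw)
    · refine top_le_iff.1 ((T.adjoin_ζL_wL n).symm.le.trans
        (IntermediateField.adjoin.mono _ _ _ ?_))
      rintro x (rfl | rfl) <;>
      rw [mem_rootSet] <;>
      refine ⟨mul_ne_zero (hne _) (hne _), ?_⟩
      · simp [hζ]
      · simp [hw]
  exact Normal.of_isSplittingField ((X ^ p ^ n - C 1) * (X ^ p ^ n - C a) : k[X])

/-- The Galois group `Γ_n` of `k(ζ n, w n) / k`. -/
abbrev Γ (T : RadicalTower p a Ω) (n : ℕ) : Type _ := T.L n ≃ₐ[k] T.L n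

/-- The Galois group `N_n` of `k(ζ n, w n) / k(ζ n)`. -/
def N (T : RadicalTower p a Ω) (n : ℕ) : Subgroup (T.Γ n) :=
  (IntermediateField.restrict (T.E_le_L n)).fixingSubgroup

/-- The Galois group `Δ_n` of `k(ζ n, w n) / k(w n)`. -/
def Δ (T : RadicalTower p a Ω) (n : ℕ) : Subgroup (T.Γ n) :=
  (IntermediateField.restrict (T.K_le_L n)).fixingSubgroup

theorem mem_N (T : RadicalTower p a Ω) (n : ℕ) (σ : T.Γ n) :
    σ ∈ T.N n ↔ σ (T.ζL n) = T.ζL n := by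
  rw [N, IntermediateField.mem_fixingSubgroup_iff]
  constructor
  · intro h
    exact h _ ((IntermediateField.mem_restrict _ _).2
      (IntermediateField.subset_adjoin _ _ (Set.mem_singleton _)))
  · intro h x hx
    have hx' : (x : Ω) ∈ T.E n := (IntermediateField.mem_restrict _ _).1 hx
    have h1 : T.E n ≤ (IntermediateField.fixedField (Subgroup.zpowers σ)).map (T.L n).val := by
      refine IntermediateField.adjoin_le_iff.2 ?_
      rintro y rfl
      refine ⟨T.ζL n, ?_, rfl⟩
      refine (IntermediateField.mem_fixedField_iff _ _).2 fun τ hτ => ?_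
      have : Subgroup.zpowers σ ≤ MulAction.stabilizer (T.Γ n) (T.ζL n) := by
        rw [Subgroup.zpowers_le]
        exact h
      exact this hτ
    obtain ⟨y, hy, hyx⟩ := h1 hx'
    have : y = x := Subtype.ext hyx
    subst this
    exact (IntermediateField.mem_fixedField_iff _ _).1 hy σ (Subgroup.mem_zpowers σ)

instance [hp : Fact p.Prime] (T : RadicalTower p a Ω) (n : ℕ) : (T.N n).Normal := by
  refine ⟨fun σ hσ γ => ?_⟩
  rw [mem_N] at hσ ⊢
  have : NeZero (p ^ n) := ⟨pow_ne_zero _ hp.out.ne_zero⟩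
  obtain ⟨i, -, hi⟩ := (T.ζL_prim n).eq_pow_of_pow_eq_one (ξ := γ⁻¹ (T.ζL n))
    (by rw [← map_pow, (T.ζL_prim n).pow_eq_one, map_one])
  rw [AlgEquiv.mul_apply, AlgEquiv.mul_apply, ← hi, map_pow, hσ, hi, ← AlgEquiv.mul_apply,
    mul_inv_cancel, AlgEquiv.one_apply]

/-- The restriction of automorphisms `Γ_j → Γ_i` for `i ≤ j`. -/
noncomputable def res [Fact p.Prime] (T : RadicalTower p a Ω) {i j : ℕ} (hij : i ≤ j) :
    T.Γ j →* T.Γ i :=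
  letI : Algebra (T.L i) (T.L j) := (IntermediateField.inclusion (T.L_mono hij)).toAlgebra
  haveI : IsScalarTower k (T.L i) (T.L j) := IsScalarTower.of_algebraMap_eq'
    (IntermediateField.inclusion (T.L_mono hij)).comp_algebraMap.symm
  haveI := T.normal_L i
  AlgEquiv.restrictNormalHom (T.L i)

theorem res_apply [Fact p.Prime] (T : RadicalTower p a Ω) {i j : ℕ} (hij : i ≤ j) (σ : T.Γ j)
    (x : T.L i) : IntermediateField.inclusion (T.L_mono hij) (T.res hij σ x) =
      σ (IntermediateField.inclusion (T.L_mono hij) x) := by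
  let _ : Algebra (T.L i) (T.L j) := (IntermediateField.inclusion (T.L_mono hij)).toAlgebra
  have : IsScalarTower k (T.L i) (T.L j) := IsScalarTower.of_algebraMap_eq'
    (IntermediateField.inclusion (T.L_mono hij)).comp_algebraMap.symm
  have := T.normal_L i
  exact AlgEquiv.restrictNormal_commutes σ (T.L i) x

theorem ζ_pow (T : RadicalTower p a Ω) {i j : ℕ} (hij : i ≤ j) :
    T.ζ j ^ p ^ (j - i) = T.ζ i := by
  induction j, hij using Nat.le_induction with
  | base => simp
  | succ j hij ih => rw [Nat.succ_sub hij, pow_succ', pow_mul, T.ζ_succ, ih]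

/-- The restriction of automorphisms `N_j → N_i` for `i ≤ j`. -/
noncomputable def resN [Fact p.Prime] (T : RadicalTower p a Ω) {i j : ℕ} (hij : i ≤ j) :
    T.N j →* T.N i :=
  ((T.res hij).comp (T.N j).subtype).codRestrict (T.N i) (fun σ => by
    have hσ := (T.mem_N j σ).1 σ.2
    rw [mem_N]
    apply (IntermediateField.inclusion (T.L_mono hij)).injective
    have h1 : IntermediateField.inclusion (T.L_mono hij) (T.ζL i) = T.ζL j ^ p ^ (j - i) :=
      Subtype.ext (T.ζ_pow hij).symm
    have h2 : (σ : T.Γ j) (T.ζL j ^ p ^ (j - i)) = T.ζL j ^ p ^ (j - i) := by rw [map_pow, hσ]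
    exact (T.res_apply hij _ _).trans ((congrArg (σ : T.Γ j) h1).trans (h2.trans h1.symm)))

/-- The group algebra `k(ζ n, w n)[N_n]`, which contains `k(ζ n)[N_n]`. -/
abbrev GroupAlg (T : RadicalTower p a Ω) (n : ℕ) : Type _ := MonoidAlgebra (T.L n) (T.N n)

/-- The diagonal action of `γ` in `Γ_n` on `k(ζ n, w n)[N_n]`: on the coefficients through the
Galois action and on `N_n` by conjugation. -/
noncomputable def diag [Fact p.Prime] (T : RadicalTower p a Ω) (n : ℕ) (γ : T.Γ n) :
    T.GroupAlg n →+* T.GroupAlg n :=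
  (MonoidAlgebra.mapDomainRingHom (T.L n) (MulAut.conjNormal γ : MulAut (T.N n)).toMonoidHom).comp
    (MonoidAlgebra.mapRingHom (T.N n) (γ : T.L n →+* T.L n))

/-- `H_n = (k(ζ n)[N_n])^{Δ_n}`, the ring of fixed elements of `k(ζ n)[N_n]` under the diagonal
action of `Δ_n`, as a subring of `k(ζ n, w n)[N_n]`. -/
noncomputable def fixedRing [Fact p.Prime] (T : RadicalTower p a Ω) (n : ℕ) :
    Subring (T.GroupAlg n) :=
  (MonoidAlgebra.mapRingHom (T.N n)
    (algebraMap (IntermediateField.restrict (T.E_le_L n)) (T.L n))).range ⊓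
  ⨅ δ ∈ T.Δ n, (T.diag n δ).eqLocus (RingHom.id _)

/-- `H_n = (k(ζ n)[N_n])^{Δ_n}` as a type; it carries only its ring structure. -/
def H [Fact p.Prime] (T : RadicalTower p a Ω) (n : ℕ) : Type _ := T.fixedRing n

noncomputable instance [Fact p.Prime] (T : RadicalTower p a Ω) (n : ℕ) : Ring (T.H n) :=
  inferInstanceAs (Ring (T.fixedRing n))

/-- The inclusion of `H_n` in `k(ζ n, w n)[N_n]`. -/
noncomputable def incl [Fact p.Prime] (T : RadicalTower p a Ω) (n : ℕ) : T.H n →+* T.GroupAlg n :=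
  (T.fixedRing n).subtype

/-- The inclusion of `H_n` in `Ω[N_n]`. -/
noncomputable def inclΩ [Fact p.Prime] (T : RadicalTower p a Ω) (n : ℕ) :
    T.H n →+* MonoidAlgebra Ω (T.N n) :=
  (MonoidAlgebra.mapRingHom (T.N n) (algebraMap (T.L n) Ω)).comp (T.incl n)

/-- The profinite Hopf algebra `H_∞ = lim H_n` and its action on the tower `k(w n)`, as obtained
from the group algebras: the Hopf algebra structure of `H_n` is the restriction of that of the group
algebra (for which `σ ∈ N_n` is group-like), the transition maps `H_j → H_i` are the restrictions of
the maps `Ω[N_j] → Ω[N_i]` that are the identity on `Ω` and the restriction of automorphisms on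
`N_j`, and `∑ c_σ σ ∈ H_n` sends `x ∈ k(w n)` to `∑ c_σ σ(x)`. -/
structure HopfSystem [Fact p.Prime] (T : RadicalTower p a Ω) [∀ n, HopfAlgebra k (T.H n)] extends
    ProfiniteHopfAction k T.K T.H where
  incl_algebraMap : ∀ (n : ℕ) (r : k),
    T.incl n (algebraMap k (T.H n) r) = algebraMap k (T.GroupAlg n) r
  incl_counit : ∀ (n : ℕ) (h : T.H n), algebraMap k (T.L n) (Coalgebra.counit (R := k) h) =
    Coalgebra.counit (R := T.L n) (T.incl n h)
  incl_comul : ∀ (n : ℕ) (h : T.H n) {ι : Type} (R : Coalgebra.Repr k h ι),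
    ∑ i ∈ R.index, T.incl n (R.left i) ⊗ₜ[T.L n] T.incl n (R.right i) =
      Coalgebra.comul (R := T.L n) (T.incl n h)
  incl_ν : ∀ {i j : ℕ} (hij : i ≤ j) (h : T.H j), T.inclΩ i (ν hij h) =
    MonoidAlgebra.mapDomainRingHom Ω (T.resN hij) (T.inclΩ j h)
  act_apply : ∀ (n : ℕ) (h : T.H n) (x : T.K n), (act n h x : Ω) =
    (T.incl n h).coeff.sum fun σ c =>
      (c : Ω) * ((σ : T.Γ n) (IntermediateField.inclusion (T.K_le_L n) x) : Ω)

end RadicalTower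

/-! ### Rational `p`-th powers in cyclotomic fields -/

section Cyclotomic

/-! Everything reduces to one fact: in the eigenbasis 1, `w_n`, `w_n`², ... of `k(w_n)`, the algebra
`H_n` is the full algebra of diagonal matrices.

The arithmetic input is that `a`, not being a `p`-th power in ℚ, does not become one in any ℚ(ζ_n)
(`IsCyclotomicExtension.pow_ne_of_forall_pow_ne`). Since `p` is odd, X^(p^n) - a is then irreducible
over ℚ and over ℚ(ζ_n). Hence `w_n` has degree p^n over ℚ, the group `N_n` has order p^n, and χ(σ) =
σ(w_n)/w_n is an injective character of `N_n` with values in the p^n-th roots of unity.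

Evaluation at the powers χ^j identifies L[N_n], for L = k(ζ_n, w_n), with the functions on ℤ/p^n;
this is Fourier inversion on a cyclic group. As Δ_n fixes `w_n`, one has χ(δσδ⁻¹) = δ(χ(σ)), so the
diagonal action becomes the Galois action on the values (`charEval_diag`). The values of an element
of `H_n` are therefore fixed by both `N_n` and Δ_n, so they lie in k (`exists_algebraMap_eq`), and
every k-valued function occurs (`exists_of_values`). Thus `H_n` is k^(ℤ/p^n), and h multiplies
`w_n`^s by its value h(s).

In these coordinates the Hopf structure is that of the functions on the group ℤ/p^n, that is, Δ(e_j)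
is the sum of the e_i ⊗ e_(j-i). Because `w_i` = `w_j`^(p^(j-i)), the transition map `H_j` → `H_i`
is pullback along multiplication by p^(j-i) from ℤ/p^i to ℤ/p^j. The module algebra axioms say that
`k(w_n)` is graded by ℤ/p^n.

A linear map on `k(w_n)` is given by arbitrary images of the basis vectors, and in A ⊗ H_n the
element c ⊗ e_j sends the j-th basis vector to c times itself and kills the others. As basis vectors
are invertible, all the maps from A ⊗ H_n to Hom are bijective (`evalMap_bijective_of_diagonal`). An
endomorphism of the union is a compatible family of its restrictions to the `k(w_n)`, so the
isomorphism at infinity is the inverse limit of these bijections (`toEnd_bijective`). The compatible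
family of idempotents e_0 projects onto k and has counit 1, which determines the fixed elements. -/

open Polynomial in
theorem IsCyclotomicExtension.exists_algEquiv_inv_of_pow_eq_one {m : ℕ} [NeZero m] (E : Type*)
    [Field E] [Algebra ℚ E] [IsCyclotomicExtension {m} ℚ E] :
    ∃ c : E ≃ₐ[ℚ] E, ∀ x : E, x ^ m = 1 → c x = x⁻¹ := by
  have hζ := IsCyclotomicExtension.zeta_spec m ℚ E
  have hζ' : IsPrimitiveRoot (IsCyclotomicExtension.zeta m ℚ E)⁻¹ m := hζ.inv
  have hirr := cyclotomic.irreducible_rat (NeZero.pos m)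
  -- A primitive root and its inverse share the cyclotomic polynomial as minimal polynomial, so some
  -- automorphism, an algebraic complex conjugation, exchanges them.
  have hmin : minpoly ℚ (hζ.powerBasis ℚ).gen = minpoly ℚ (hζ'.powerBasis ℚ).gen := by
    rw [IsPrimitiveRoot.powerBasis_gen, IsPrimitiveRoot.powerBasis_gen,
      ← hζ.minpoly_eq_cyclotomic_of_irreducible hirr,
      ← hζ'.minpoly_eq_cyclotomic_of_irreducible hirr]
  refine ⟨(hζ.powerBasis ℚ).equivOfMinpoly (hζ'.powerBasis ℚ) hmin, fun x hx => ?_⟩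
  have hgen := (hζ.powerBasis ℚ).equivOfMinpoly_gen (hζ'.powerBasis ℚ) hmin
  rw [IsPrimitiveRoot.powerBasis_gen, IsPrimitiveRoot.powerBasis_gen] at hgen
  obtain ⟨i, -, rfl⟩ := hζ.eq_pow_of_pow_eq_one hx
  rw [map_pow, hgen, inv_pow]

/-- A `p`-th root of `a` can be adjusted by a `p`-th root of unity so that complex conjugation `c`
fixes it. Since the Galois group is abelian, its quotients by its conjugates are roots of unity
fixed by `c`, hence ±1, hence 1 as `p` is odd. The adjusted root is then rational. -/
theorem IsCyclotomicExtension.pow_ne_of_forall_pow_ne {p m : ℕ} (hp : Odd p) (hpm : p ∣ m)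
    [NeZero m] {a : ℚ} (ha : ∀ b : ℚ, b ^ p ≠ a) {E : Type*} [Field E] [Algebra ℚ E]
    [IsCyclotomicExtension {m} ℚ E] (b : E) : b ^ p ≠ algebraMap ℚ E a := by
  intro hb
  obtain ⟨k, rfl⟩ := hp
  have : IsGalois ℚ E := IsCyclotomicExtension.isGalois {m} ℚ E
  have : FiniteDimensional ℚ E := IsCyclotomicExtension.finiteDimensional {m} ℚ E
  have hcomm := (IsCyclotomicExtension.isMulCommutative {m} ℚ E).is_comm.comm
  obtain ⟨c, hc⟩ := IsCyclotomicExtension.exists_algEquiv_inv_of_pow_eq_one (m := m) E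
  have hroot : ∀ x : E, x ^ (2 * k + 1) = 1 → c x = x⁻¹ := fun x hx => hc x <| by
    obtain ⟨q, rfl⟩ := hpm
    rw [pow_mul, hx, one_pow]
  have ha0 : a ≠ 0 := fun h => ha 0 (by rw [h, zero_pow (by omega)])
  have ha0' : algebraMap ℚ E a ≠ 0 := fun h => ha0 ((algebraMap ℚ E).injective (h.trans (map_zero _).symm))
  have hquot : ∀ (σ : E ≃ₐ[ℚ] E) (x : E), x ^ (2 * k + 1) = algebraMap ℚ E a →
      (σ x / x) ^ (2 * k + 1) = 1 := fun σ x hx => by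
    rw [div_pow, ← map_pow, hx, AlgEquiv.commutes, div_self ha0']
  have hne : ∀ x : E, x ^ (2 * k + 1) = algebraMap ℚ E a → x ≠ 0 := by
    rintro x hx rfl
    exact ha0' (by rw [← hx, zero_pow (by omega)])
  set ξ : E := c b / b with hξ
  have hξ1 := hquot c b hb
  have hξ0 : ξ ≠ 0 := fun h => by rw [← hξ, h, zero_pow (by omega)] at hξ1; exact zero_ne_one hξ1
  -- With `p = 2 * k + 1`, the exponent `k + 1` is the inverse of 2 modulo `p`: since `c` sends ξ^t
  -- b to ξ^(1-t) b, invariance requires 2t ≡ 1.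
  set b' : E := ξ ^ (k + 1) * b with hb'
  have hb'a : b' ^ (2 * k + 1) = algebraMap ℚ E a := by
    rw [hb', mul_pow, ← pow_mul, mul_comm, mul_comm (k + 1), pow_mul, hξ1, one_pow, mul_one, hb]
  have hcb' : c b' = b' := by
    have h1 : c b = ξ * b := by rw [hξ, div_mul_cancel₀ _ (hne b hb)]
    rw [hb', map_mul, map_pow, hroot ξ hξ1, h1, inv_pow, ← mul_assoc]
    congr 1
    rw [inv_mul_eq_iff_eq_mul₀ (pow_ne_zero _ hξ0), ← pow_add,
      show k + 1 + (k + 1) = (2 * k + 1) + 1 by ring, pow_succ, hξ1, one_mul]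
  have hfix : ∀ σ : E ≃ₐ[ℚ] E, σ b' = b' := by
    intro σ
    have hη1 := hquot σ b' hb'a
    have h2 : c (σ b' / b') = σ b' / b' := by
      rw [map_div₀, hcb', ← AlgEquiv.mul_apply, hcomm, AlgEquiv.mul_apply, hcb']
    rw [hroot _ hη1] at h2
    set η := σ b' / b' with hη
    have hη0 : η ≠ 0 := fun h => by rw [h, zero_pow (by omega)] at hη1; exact zero_ne_one hη1
    have h3 : η ^ 2 = 1 := by
      rw [pow_two]
      nth_rw 1 [← h2]
      exact inv_mul_cancel₀ hη0
    rw [pow_succ, pow_mul, h3, one_pow, one_mul] at hη1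
    rwa [hη, div_eq_one_iff_eq (hne b' hb'a)] at hη1
  obtain ⟨q, hq⟩ := IntermediateField.mem_bot.1 ((IsGalois.mem_bot_iff_fixed b').2 hfix)
  refine ha q ((algebraMap ℚ E).injective ?_)
  rw [map_pow, hq, hb'a]

theorem IsPrimitiveRoot.intermediateField_adjoin_isCyclotomicExtension' {k Ω : Type*} [Field k]
    [Field Ω] [Algebra k Ω] {n : ℕ} [NeZero n] {ζ : Ω} (hζ : IsPrimitiveRoot ζ n) :
    IsCyclotomicExtension {n} k (IntermediateField.adjoin k {ζ}) := by
  change IsCyclotomicExtension {n} k (IntermediateField.adjoin k {ζ}).toSubalgebra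
  rw [IntermediateField.adjoin_simple_toSubalgebra_of_isAlgebraic
    (hζ.isIntegral (NeZero.pos n)).tower_top.isAlgebraic]
  exact hζ.adjoin_isCyclotomicExtension k

end Cyclotomic

/-! ### Degrees and Galois groups in the radical tower -/

namespace RadicalTower

variable {p : ℕ} {Ω : Type*} [Field Ω]

section General

variable {k : Type*} [Field k] {a : k} [Algebra k Ω]

theorem K_mono (T : RadicalTower p a Ω) : Monotone T.K := by
  refine monotone_nat_of_le_succ fun n => IntermediateField.adjoin_le_iff.2 ?_
  rintro x rfl
  change T.w n ∈ T.K (n + 1)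
  rw [← T.w_succ]
  exact pow_mem (IntermediateField.subset_adjoin _ _ (Set.mem_singleton _)) _

theorem E_mono (T : RadicalTower p a Ω) : Monotone T.E := by
  refine monotone_nat_of_le_succ fun n => IntermediateField.adjoin_le_iff.2 ?_
  rintro x rfl
  change T.ζ n ∈ T.E (n + 1)
  rw [← T.ζ_succ]
  exact pow_mem (IntermediateField.subset_adjoin _ _ (Set.mem_singleton _)) _

theorem w_pow_sub (T : RadicalTower p a Ω) {i j : ℕ} (hij : i ≤ j) :
    T.w j ^ p ^ (j - i) = T.w i := by
  induction j, hij using Nat.le_induction with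
  | base => simp
  | succ j hij ih => rw [Nat.succ_sub hij, pow_succ', pow_mul, T.w_succ, ih]

/-- `w n` as an element of `k(w n)`. -/
def wK (T : RadicalTower p a Ω) (n : ℕ) : T.K n :=
  ⟨T.w n, IntermediateField.subset_adjoin _ _ (Set.mem_singleton _)⟩

theorem inclusion_wK (T : RadicalTower p a Ω) (n : ℕ) :
    IntermediateField.inclusion (T.K_le_L n) (T.wK n) = T.wL n := rfl

theorem wK_pow (T : RadicalTower p a Ω) (n : ℕ) :
    T.wK n ^ p ^ n = algebraMap k (T.K n) a := Subtype.ext (T.w_pow n)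

variable [hp : Fact p.Prime]

theorem isIntegral_wK (T : RadicalTower p a Ω) (n : ℕ) : IsIntegral k (T.wK n) :=
  IsIntegral.of_pow (Nat.pos_of_ne_zero (pow_ne_zero n hp.out.ne_zero))
    (by rw [wK_pow]; exact isIntegral_algebraMap)

theorem finiteDimensional_L (T : RadicalTower p a Ω) (n : ℕ) : FiniteDimensional k (T.L n) := by
  have : NeZero (p ^ n) := ⟨pow_ne_zero _ hp.out.ne_zero⟩
  have hζi : IsIntegral k (T.ζL n) := ((T.ζL_prim n).isIntegral (NeZero.pos _)).tower_top
  have hwi : IsIntegral k (T.wL n) := (T.isIntegral_wK n).map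
    (IntermediateField.inclusion (T.K_le_L n))
  have h1 : FiniteDimensional k (IntermediateField.adjoin k ({T.ζL n, T.wL n} : Set (T.L n))) :=
    IntermediateField.finiteDimensional_adjoin (by rintro x (rfl | rfl) <;> assumption)
  rw [T.adjoin_ζL_wL n] at h1
  exact (IntermediateField.topEquiv (F := k) (E := T.L n)).toLinearEquiv.finiteDimensional

theorem isGalois_L [CharZero k] (T : RadicalTower p a Ω) (n : ℕ) : IsGalois k (T.L n) :=
  have := T.normal_L n
  ⟨⟩

end General

/-- A tower is called nondegenerate if `p` is odd and `a` does not become a `p`-th power in any of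
the fields `k(ζ n)`. -/
structure Nondegenerate {k : Type*} [Field k] {a : k} [Algebra k Ω] (T : RadicalTower p a Ω) :
    Prop where
  ne_two : p ≠ 2
  pow_ne : ∀ (n : ℕ), ∀ x ∈ T.E n, x ^ p ≠ algebraMap k Ω a

theorem nondegenerate [hp : Fact p.Prime] {a : ℚ} [Algebra ℚ Ω] (T : RadicalTower p a Ω)
    (hp2 : p ≠ 2) (ha : ∀ b : ℚ, b ^ p ≠ a) : T.Nondegenerate := by
  refine ⟨hp2, fun n b hbE hb => ?_⟩
  -- Passing to level `n + 1` ensures that `p` divides the conductor, also when `n = 0`.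
  have : NeZero (p ^ (n + 1)) := ⟨pow_ne_zero _ hp.out.ne_zero⟩
  have : IsCyclotomicExtension {p ^ (n + 1)} ℚ (T.E (n + 1)) := by
    -- The field carries a ℚ-algebra structure as a division ring and one as an intermediate field;
    -- they agree, such a structure being unique.
    rw [Subsingleton.elim (DivisionRing.toRatAlgebra : Algebra ℚ (T.E (n + 1)))
      (T.E (n + 1)).algebra']
    exact (T.ζ_prim (n + 1)).intermediateField_adjoin_isCyclotomicExtension' (k := ℚ)
  refine IsCyclotomicExtension.pow_ne_of_forall_pow_ne (hp.out.odd_of_ne_two hp2)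
    (dvd_pow_self p n.succ_ne_zero) ha
    (⟨b, T.E_mono n.le_succ hbE⟩ : T.E (n + 1)) ?_
  refine Subtype.ext (hb.trans ?_)
  simp

namespace Nondegenerate

variable {k : Type*} [Field k] {a : k} [Algebra k Ω] {T : RadicalTower p a Ω}

theorem base_pow_ne (hT : T.Nondegenerate) (b : k) : b ^ p ≠ a := fun h =>
  hT.pow_ne 0 (algebraMap k Ω b) ((T.E 0).algebraMap_mem b) (by rw [← map_pow, h])

variable [hp : Fact p.Prime]

theorem w_ne_zero (hT : T.Nondegenerate) (n : ℕ) : T.w n ≠ 0 := fun h => by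
  refine hT.pow_ne 0 0 (zero_mem _) ?_
  rw [← T.w_pow n, h, zero_pow hp.out.ne_zero, zero_pow (pow_ne_zero _ hp.out.ne_zero)]

-- Irreducibility of X^(p^n) - a needs only that `a` is not a `p`-th power, because `p` is odd; for
-- exponent 4 the polynomial X⁴ + 4 shows that this would fail.
open Polynomial in
theorem minpoly_wK (hT : T.Nondegenerate) (n : ℕ) :
    minpoly k (T.wK n) = X ^ p ^ n - C a := by
  refine (minpoly.eq_of_irreducible_of_monic
    (X_pow_sub_C_irreducible_of_prime_pow hp.out hT.ne_two n hT.base_pow_ne) ?_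
    (monic_X_pow_sub_C a (pow_ne_zero _ hp.out.ne_zero))).symm
  simp [wK_pow]

theorem finrank_K (hT : T.Nondegenerate) (n : ℕ) : Module.finrank k (T.K n) = p ^ n := by
  have hi : IsIntegral k (T.w n) := (T.isIntegral_wK n).map (T.K n).val
  rw [K, IntermediateField.adjoin.finrank hi]
  change (minpoly k ((T.K n).val (T.wK n))).natDegree = _
  rw [minpoly.algHom_eq _ (T.K n).val.injective, hT.minpoly_wK,
    Polynomial.natDegree_X_pow_sub_C]

theorem linearIndependent_wK_pow (hT : T.Nondegenerate) (n : ℕ) :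
    LinearIndependent k fun l : ZMod (p ^ n) => T.wK n ^ l.val := by
  have : NeZero (p ^ n) := ⟨pow_ne_zero _ hp.out.ne_zero⟩
  have hd : (minpoly k (T.wK n)).natDegree = p ^ n := by
    rw [hT.minpoly_wK, Polynomial.natDegree_X_pow_sub_C]
  exact (linearIndependent_pow (K := k) (T.wK n)).comp
    (fun l : ZMod (p ^ n) => ⟨l.val, hd.symm ▸ ZMod.val_lt l⟩)
    fun l l' h => ZMod.val_injective _ (Fin.mk.inj h)

/-- The basis of `k(w n)` consisting of the powers of `w n`. -/
noncomputable def basisK (hT : T.Nondegenerate) (n : ℕ) : Module.Basis (ZMod (p ^ n)) k (T.K n) :=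
  haveI : NeZero (p ^ n) := ⟨pow_ne_zero _ hp.out.ne_zero⟩
  basisOfLinearIndependentOfCardEqFinrank (hT.linearIndependent_wK_pow n)
    (by rw [ZMod.card, hT.finrank_K])

theorem basisK_apply (hT : T.Nondegenerate) (n : ℕ) (l : ZMod (p ^ n)) :
    hT.basisK n l = T.wK n ^ l.val := by
  simp [basisK]

-- The irreducibility argument is repeated over k(ζ_n), where `a` is still not a `p`-th power; so `w
-- n` has degree p^n there, and it generates the field `T.L n` over k(ζ_n).
open Polynomial in
theorem card_N [CharZero k] (hT : T.Nondegenerate) (n : ℕ) : Nat.card (T.N n) = p ^ n := by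
  have hpn : p ^ n ≠ 0 := pow_ne_zero _ hp.out.ne_zero
  have := T.isGalois_L n
  have := T.finiteDimensional_L n
  set E' := IntermediateField.restrict (T.E_le_L n) with hE'
  have hirr : Irreducible (X ^ p ^ n - C (algebraMap k E' a)) := by
    refine X_pow_sub_C_irreducible_of_prime_pow hp.out hT.ne_two n fun b hb => ?_
    exact hT.pow_ne n _ ((IntermediateField.mem_restrict _ _).1 b.2)
      (congrArg (fun x : E' => ((x : T.L n) : Ω)) hb)
  have hmin : minpoly E' (T.wL n) = X ^ p ^ n - C (algebraMap k E' a) := by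
    refine (minpoly.eq_of_irreducible_of_monic hirr ?_ (monic_X_pow_sub_C _ hpn)).symm
    have hw : T.wL n ^ p ^ n = algebraMap k (T.L n) a := Subtype.ext (T.w_pow n)
    rw [map_sub, map_pow, aeval_X, aeval_C, hw, ← IsScalarTower.algebraMap_apply, sub_self]
  have htop : IntermediateField.adjoin E' {T.wL n} = ⊤ := by
    have h1 : ⊤ ≤ (IntermediateField.adjoin E' {T.wL n}).restrictScalars k := by
      rw [← T.adjoin_ζL_wL n]
      refine IntermediateField.adjoin_le_iff.2 ?_
      rintro x (rfl | rfl)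
      · have hm : T.ζL n ∈ E' := (IntermediateField.mem_restrict _ _).2
          (IntermediateField.subset_adjoin _ _ (Set.mem_singleton _))
        exact (IntermediateField.adjoin E' {T.wL n}).algebraMap_mem ⟨T.ζL n, hm⟩
      · exact IntermediateField.subset_adjoin E' _ (Set.mem_singleton _)
    exact eq_top_iff.2 fun x _ => h1 (IntermediateField.mem_top (F := k))
  have hwi : IsIntegral k (T.wL n) := (T.isIntegral_wK n).map
    (IntermediateField.inclusion (T.K_le_L n))
  rw [N, IsGalois.card_fixingSubgroup_eq_finrank, ← hE', ← IntermediateField.finrank_top', ← htop,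
    IntermediateField.adjoin.finrank hwi.tower_top, hmin, natDegree_X_pow_sub_C]

end Nondegenerate

end RadicalTower

/-! ### Fourier inversion for a finite group with an injective character -/

section Fourier

variable {R N : Type*} [Field R] [Group N] {m : ℕ} {χ : N →* R}

/-- A group that embeds in the multiplicative group of a field is cyclic, so its exponent is `m` and
χ^s is trivial exactly when `m` divides `s`. The values of a nontrivial character sum to zero. -/
theorem sum_pow_of_injective [Fintype N] (hχ : Function.Injective χ) (hm : Nat.card N = m) (s : ℕ) :
    ∑ σ, χ σ ^ s = if (s : ZMod m) = 0 then (m : R) else 0 := by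
  have : IsCyclic N := isCyclic_of_injective_ringHom χ hχ
  split_ifs with h
  · rw [ZMod.natCast_eq_zero_iff, ← hm] at h
    have : ∀ σ : N, χ σ ^ s = 1 := fun σ => by
      rw [← map_pow, orderOf_dvd_iff_pow_eq_one.1 ((orderOf_dvd_natCard σ).trans h), map_one]
    simp [this, ← hm]
  · rw [← sum_hom_units_eq_zero (χ ^ s) fun h1 => h ?_]
    · rfl
    · rw [ZMod.natCast_eq_zero_iff, ← hm, ← IsCyclic.exponent_eq_card,
        Monoid.exponent_dvd_iff_forall_pow_eq_one]
      intro σ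
      apply hχ
      rw [map_pow, map_one]
      exact DFunLike.congr_fun h1 σ

/-- This lets powers of χ, which have natural exponents, be indexed by `ZMod m`. -/
theorem pow_eq_of_natCast_eq [Finite N] (hm : Nat.card N = m) (σ : N) {s t : ℕ}
    (h : (s : ZMod m) = t) : χ σ ^ s = χ σ ^ t := by
  rw [← map_pow, ← map_pow]
  congr 1
  rw [pow_eq_pow_iff_modEq]
  rw [ZMod.natCast_eq_natCast_iff, ← hm] at h
  exact h.of_dvd (orderOf_dvd_natCard σ)

namespace MonoidAlgebra

/-- The evaluation of elements of a group algebra at the `s`-th power of a character. -/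
noncomputable def charEval (χ : N →* R) (s : ℕ) : MonoidAlgebra R N →ₐ[R] R :=
  MonoidAlgebra.lift R R N (χ ^ s)

theorem charEval_apply (χ : N →* R) (s : ℕ) (x : MonoidAlgebra R N) :
    charEval χ s x = x.coeff.sum fun σ c => c * χ σ ^ s := by
  rw [charEval, MonoidAlgebra.lift_apply]
  rfl

theorem charEval_single (χ : N →* R) (s : ℕ) (σ : N) (c : R) :
    charEval χ s (single σ c) = c * χ σ ^ s := by
  rw [charEval_apply, coeff_single, Finsupp.sum_single_index (zero_mul _)]

variable [Finite N]

/-- The idempotent of a group algebra that belongs to the `j`-th power of a character. -/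
noncomputable def charIdem (χ : N →* R) (j : ZMod m) : MonoidAlgebra R N :=
  .ofCoeff (Finsupp.ofSupportFinite (fun σ => (m : R)⁻¹ * χ σ ^ (-j).val) (Set.toFinite _))

theorem coeff_charIdem (χ : N →* R) (j : ZMod m) (σ : N) :
    (charIdem χ j).coeff σ = (m : R)⁻¹ * χ σ ^ (-j).val := rfl

theorem charIdem_eq_sum [Fintype N] (χ : N →* R) (j : ZMod m) :
    charIdem χ j = ∑ σ, single σ ((m : R)⁻¹ * χ σ ^ (-j).val) := by
  classical
  ext σ
  rw [coeff_sum, Finsupp.finsetSum_apply]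
  simp [coeff_charIdem, Finsupp.single_apply]

variable [NeZero m]

/-- Orthogonality of characters: the value is the mean of χ^(s-j) over the group, the natural number
`(-j).val` standing for the exponent -j. -/
theorem charEval_charIdem (hχ : Function.Injective χ) (hm : Nat.card N = m) (h0 : (m : R) ≠ 0)
    (s : ℕ) (j : ZMod m) : charEval χ s (charIdem χ j) = if (s : ZMod m) = j then 1 else 0 := by
  have := Fintype.ofFinite N
  rw [charIdem_eq_sum, map_sum]
  simp only [charEval_single, mul_assoc, ← pow_add]
  rw [← Finset.mul_sum, sum_pow_of_injective hχ hm]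
  have : (((-j).val + s : ℕ) : ZMod m) = 0 ↔ (s : ZMod m) = j := by
    rw [Nat.cast_add, ZMod.natCast_zmod_val, neg_add_eq_zero, eq_comm]
  simp only [this]
  split_ifs
  · exact inv_mul_cancel₀ h0
  · exact mul_zero _

/-- The element of a group algebra with given values at the powers of a character. -/
noncomputable def charSum (χ : N →* R) (f : ZMod m → R) : MonoidAlgebra R N :=
  ∑ j, f j • charIdem χ j

theorem coeff_charSum (χ : N →* R) (f : ZMod m → R) (σ : N) :
    (charSum χ f).coeff σ = ∑ j, f j * ((m : R)⁻¹ * χ σ ^ (-j).val) := by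
  rw [charSum, coeff_sum, Finsupp.finsetSum_apply]
  rfl

theorem charEval_charSum (hχ : Function.Injective χ) (hm : Nat.card N = m) (h0 : (m : R) ≠ 0)
    (f : ZMod m → R) (s : ℕ) : charEval χ s (charSum χ f) = f s := by
  simp [charSum, map_sum, map_smul, charEval_charIdem hχ hm h0]

/-- The Fourier transform is onto, because `charSum` interpolates given values, and it maps between
spaces of the same dimension `m`; hence it is injective. -/
theorem eq_of_charEval_eq (hχ : Function.Injective χ) (hm : Nat.card N = m) (h0 : (m : R) ≠ 0)
    {x y : MonoidAlgebra R N} (h : ∀ j : ZMod m, charEval χ j.val x = charEval χ j.val y) :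
    x = y := by
  have := Fintype.ofFinite N
  let f : MonoidAlgebra R N →ₗ[R] (ZMod m → R) :=
    LinearMap.pi fun j => (charEval χ j.val).toLinearMap
  have hf : Function.Surjective f := by
    intro g
    refine ⟨charSum χ g, funext fun i => ?_⟩
    exact (charEval_charSum hχ hm h0 g i.val).trans (by rw [ZMod.natCast_zmod_val])
  have hd : Module.finrank R (MonoidAlgebra R N) = Module.finrank R (ZMod m → R) := by
    rw [(MonoidAlgebra.coeffLinearEquiv R).finrank_eq, Module.finrank_finsupp_self,
      Module.finrank_pi, ZMod.card, ← Nat.card_eq_fintype_card, hm]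
  have : FiniteDimensional R (MonoidAlgebra R N) :=
    (MonoidAlgebra.coeffLinearEquiv R).symm.finiteDimensional
  exact (LinearMap.injective_iff_surjective_of_finrank_eq_finrank hd).2 hf (funext h)

theorem eq_sum_charIdem (hχ : Function.Injective χ) (hm : Nat.card N = m) (h0 : (m : R) ≠ 0)
    (x : MonoidAlgebra R N) : x = ∑ j : ZMod m, charEval χ j.val x • charIdem χ j := by
  refine eq_of_charEval_eq hχ hm h0 fun i => ?_
  simp only [map_sum, map_smul, charEval_charIdem hχ hm h0, ZMod.natCast_zmod_val]
  simp

/-- Expand each group-like σ ⊗ σ in idempotents, with coefficients χ(σ)^i χ(σ)^l; summation over σ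
leaves the pairs with i + l = j. -/
theorem comul_charIdem (hχ : Function.Injective χ) (hm : Nat.card N = m) (h0 : (m : R) ≠ 0)
    (j : ZMod m) : Coalgebra.comul (R := R) (charIdem χ j) =
      ∑ i : ZMod m, charIdem χ i ⊗ₜ[R] charIdem χ (j - i) := by
  have := Fintype.ofFinite N
  have hs : ∀ σ : N, (single σ 1 : MonoidAlgebra R N) = ∑ i : ZMod m, χ σ ^ i.val • charIdem χ i :=
    fun σ => (eq_sum_charIdem hχ hm h0 _).trans (by simp [charEval_single])
  have h1 : Coalgebra.comul (R := R) (charIdem χ j) = ∑ σ : N, ((m : R)⁻¹ * χ σ ^ (-j).val) •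
      ((single σ 1 : MonoidAlgebra R N) ⊗ₜ[R] (single σ 1 : MonoidAlgebra R N)) := by
    rw [charIdem_eq_sum, map_sum]
    refine Finset.sum_congr rfl fun σ _ => ?_
    rw [← TensorProduct.tmul_smul, smul_single, smul_eq_mul, mul_one]
    simp
  have h2 : ∀ i l : ZMod m, ∑ σ : N, (m : R)⁻¹ * χ σ ^ (-j).val * (χ σ ^ i.val * χ σ ^ l.val) =
      if l = j - i then 1 else 0 := by
    intro i l
    simp only [mul_assoc, ← pow_add]
    rw [← Finset.mul_sum, sum_pow_of_injective hχ hm]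
    have : (((-j).val + (i.val + l.val) : ℕ) : ZMod m) = 0 ↔ l = j - i := by
      simp only [Nat.cast_add, ZMod.natCast_zmod_val]
      rw [neg_add_eq_zero, eq_sub_iff_add_eq, add_comm, eq_comm]
    simp only [this]
    split_ifs
    · exact inv_mul_cancel₀ h0
    · exact mul_zero _
  calc _ = ∑ i : ZMod m, ∑ l : ZMod m, (∑ σ : N, (m : R)⁻¹ * χ σ ^ (-j).val *
        (χ σ ^ i.val * χ σ ^ l.val)) • (charIdem χ i ⊗ₜ[R] charIdem χ l) := by
        rw [h1]
        simp only [hs, TensorProduct.sum_tmul, TensorProduct.tmul_sum,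
          TensorProduct.smul_tmul_smul, Finset.smul_sum, smul_smul, Finset.sum_smul]
        rw [Finset.sum_comm]
        conv_rhs => rw [Finset.sum_comm]
        refine Finset.sum_congr rfl fun i _ => ?_
        rw [Finset.sum_comm]
    _ = _ := by simp [h2]

end MonoidAlgebra

end Fourier

/-! ### The Hopf algebra of functions on a finite abelian group -/

section DualGroupAlgebra

variable {k H G : Type*} [Field k] [Ring H] [Algebra k H] [Fintype G] [DecidableEq G]

/-- The basis of orthogonal idempotents of an algebra that is identified with an algebra of
functions. -/
noncomputable def AlgEquiv.idemBasis (f : H ≃ₐ[k] (G → k)) : Module.Basis G k H :=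
  .ofEquivFun f.toLinearEquiv

theorem AlgEquiv.apply_idemBasis (f : H ≃ₐ[k] (G → k)) (j : G) :
    f (f.idemBasis j) = Pi.single j 1 := by
  have h : f.idemBasis j = f.symm (Pi.single j 1) :=
    Module.Basis.coe_ofEquivFun f.toLinearEquiv ▸ rfl
  rw [h, f.apply_symm_apply]

theorem AlgEquiv.idemBasis_mul (f : H ≃ₐ[k] (G → k)) (i j : G) :
    f.idemBasis i * f.idemBasis j = if i = j then f.idemBasis i else 0 := by
  apply f.injective
  rw [map_mul, f.apply_idemBasis, f.apply_idemBasis]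
  split_ifs with h
  · rw [h, f.apply_idemBasis, ← Pi.single_mul, one_mul]
  · rw [map_zero]
    ext l
    rw [Pi.mul_apply, Pi.single_apply, Pi.single_apply, Pi.zero_apply]
    split_ifs with h1 h2
    · exact absurd (h1.symm.trans h2) h
    all_goals simp

theorem AlgEquiv.sum_idemBasis (f : H ≃ₐ[k] (G → k)) : ∑ j, f.idemBasis j = 1 := by
  apply f.injective
  rw [map_sum, map_one]
  simp only [f.apply_idemBasis]
  ext l
  simp [Pi.single_apply]

omit [DecidableEq G] in
theorem AlgEquiv.eq_sum_idemBasis (f : H ≃ₐ[k] (G → k)) (h : H) :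
    h = ∑ j, f h j • f.idemBasis j :=
  (f.idemBasis.sum_equivFun h).symm

variable [AddCommGroup G]

/-- The Hopf algebra structure on an algebra of functions on a finite abelian group. -/
@[reducible]
noncomputable def AlgEquiv.functionHopfAlgebra (f : H ≃ₐ[k] (G → k)) : HopfAlgebra k H :=
  let e := f.idemBasis
  let Δ : H →ₗ[k] H ⊗[k] H := e.constr k fun j => ∑ i, e i ⊗ₜ[k] e (j - i)
  let ε : H →ₗ[k] k := e.constr k fun j => if j = 0 then 1 else 0
  let S : H →ₗ[k] H := e.constr k fun j => e (-j)
  have hΔ : ∀ j, Δ (e j) = ∑ i, e i ⊗ₜ[k] e (j - i) := e.constr_basis k _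
  have hε : ∀ j, ε (e j) = if j = 0 then 1 else 0 := e.constr_basis k _
  have hS : ∀ j, S (e j) = e (-j) := e.constr_basis k _
  have hmul : ∀ i j, e i * e j = if i = j then e i else 0 := f.idemBasis_mul
  have hone : ∑ j, e j = 1 := f.sum_idemBasis
  letI C : Coalgebra k H :=
    { comul := Δ
      counit := ε
      coassoc := e.ext fun j => by
        simp only [LinearMap.comp_apply, LinearEquiv.coe_coe, hΔ, map_sum,
          LinearMap.rTensor_tmul, LinearMap.lTensor_tmul, TensorProduct.sum_tmul,
          TensorProduct.tmul_sum, TensorProduct.assoc_tmul]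
        rw [Finset.sum_comm]
        refine Finset.sum_congr rfl fun i _ => ?_
        -- Shifting the summation index by `i` puts both sides in the form of a sum over all ways to
        -- write `j` as a sum of three elements.
        rw [← Equiv.sum_comp (Equiv.addRight i)]
        refine Finset.sum_congr rfl fun l _ => ?_
        simp only [Equiv.coe_addRight, add_sub_cancel_right, sub_sub, add_comm i l]
      rTensor_counit_comp_comul := e.ext fun j => by
        simp [hΔ, hε, TensorProduct.ite_tmul, LinearMap.rTensor_tmul]
      lTensor_counit_comp_comul := e.ext fun j => by
        simp [hΔ, hε, TensorProduct.tmul_ite, LinearMap.lTensor_tmul, sub_eq_zero] }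
  letI B : Bialgebra k H := Bialgebra.mk' k H
    (by change ε 1 = 1; simp [← hone, hε])
    (fun {x y} => by
      change ε (x * y) = ε x * ε y
      have : (LinearMap.mul k H).compr₂ ε = (LinearMap.mul k k).compl₁₂ ε ε :=
        e.ext fun i => e.ext fun j => by
          simp [hmul, hε, apply_ite ε]
          grind
      exact LinearMap.congr_fun₂ this x y)
    (by
      change Δ 1 = 1
      rw [← hone, map_sum, Algebra.TensorProduct.one_def, ← hone]
      simp only [hΔ, TensorProduct.sum_tmul, TensorProduct.tmul_sum]
      rw [Finset.sum_comm]
      conv_rhs => rw [Finset.sum_comm]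
      refine Finset.sum_congr rfl fun i _ => ?_
      exact (Equiv.subRight i).sum_comp fun l => e i ⊗ₜ[k] e l)
    (fun {x y} => by
      change Δ (x * y) = Δ x * Δ y
      -- In Δ(e_i)Δ(e_j) only terms with equal first tensor factors survive, and then the second
      -- factors agree only if `i = j`.
      have : (LinearMap.mul k H).compr₂ Δ = (LinearMap.mul k (H ⊗[k] H)).compl₁₂ Δ Δ :=
        e.ext fun i => e.ext fun j => by
          simp only [LinearMap.compr₂_apply, LinearMap.mul_apply', LinearMap.compl₁₂_apply, hΔ,
            hmul, Finset.sum_mul_sum, Algebra.TensorProduct.tmul_mul_tmul, TensorProduct.ite_tmul]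
          simp only [Finset.sum_ite_eq, Finset.mem_univ, if_true, sub_left_inj,
            TensorProduct.tmul_ite, apply_ite Δ, hΔ, map_zero]
          split_ifs <;> simp
      exact LinearMap.congr_fun₂ this x y)
  { antipode := S
    mul_antipode_rTensor_comul := e.ext fun j => by
      change LinearMap.mul' k H (S.rTensor H (Δ (e j))) = algebraMap k H (ε (e j))
      -- The terms are e_(-i) e_(j-i), which vanish unless `j = 0`; for `j = 0` they are all the
      -- idempotents, with sum 1.
      simp only [hΔ, hε, map_sum, LinearMap.rTensor_tmul, hS, LinearMap.mul'_apply, hmul,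
        show ∀ i : G, -i = j - i ↔ j = 0 by intro i; rw [eq_comm, sub_eq_neg_self]]
      split_ifs
      · rw [map_one, ← hone]
        exact Equiv.sum_comp (Equiv.neg G) fun i => e i
      · simp
    mul_antipode_lTensor_comul := e.ext fun j => by
      change LinearMap.mul' k H (S.lTensor H (Δ (e j))) = algebraMap k H (ε (e j))
      simp only [hΔ, hε, map_sum, LinearMap.lTensor_tmul, hS, LinearMap.mul'_apply, hmul,
        show ∀ i : G, i = -(j - i) ↔ j = 0 by intro i; rw [neg_sub, eq_comm, sub_eq_self]]
      split_ifs
      · rw [map_one, hone]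
      · simp }

theorem AlgEquiv.comul_idemBasis (f : H ≃ₐ[k] (G → k)) (j : G) :
    letI := f.functionHopfAlgebra
    Coalgebra.comul (R := k) (f.idemBasis j) =
      ∑ i, f.idemBasis i ⊗ₜ[k] f.idemBasis (j - i) :=
  f.idemBasis.constr_basis k _ j

theorem AlgEquiv.counit_idemBasis (f : H ≃ₐ[k] (G → k)) (j : G) :
    letI := f.functionHopfAlgebra
    Coalgebra.counit (R := k) (f.idemBasis j) = if j = 0 then 1 else 0 :=
  f.idemBasis.constr_basis k _ j

/-- The pullback of functions along a homomorphism of finite abelian groups, as a homomorphism of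
bialgebras. -/
noncomputable def AlgEquiv.functionBialgHom {H' G' : Type*} [Ring H'] [Algebra k H'] [Fintype G']
    [DecidableEq G'] [AddCommGroup G'] (f : H ≃ₐ[k] (G → k)) (f' : H' ≃ₐ[k] (G' → k))
    (φ : G' →+ G) :
    letI := f.functionHopfAlgebra
    letI := f'.functionHopfAlgebra
    H →ₐc[k] H' :=
  letI := f.functionHopfAlgebra
  letI := f'.functionHopfAlgebra
  let ν : H →ₐ[k] H' := (f'.symm : (G' → k) →ₐ[k] H').comp
    ((AlgHom.pi fun g => Pi.evalAlgHom k (fun _ : G => k) (φ g)).comp (f : H →ₐ[k] (G → k)))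
  -- The indicator function of a point pulls back to the indicator function of its fibre under `φ`.
  have hν : ∀ j, ν (f.idemBasis j) = ∑ i, if φ i = j then f'.idemBasis i else 0 := by
    intro j
    refine (f'.eq_sum_idemBasis _).trans (Finset.sum_congr rfl fun i _ => ?_)
    have : f' (ν (f.idemBasis j)) i = f (f.idemBasis j) (φ i) :=
      congrFun (f'.apply_symm_apply _) i
    rw [this, f.apply_idemBasis, Pi.single_apply]
    split_ifs <;> simp
  { ν with
    map_smul' := map_smul ν
    counit_comp := f.idemBasis.ext fun j => by
      change Coalgebra.counit (R := k) (ν (f.idemBasis j)) = Coalgebra.counit (R := k) _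
      rw [hν, map_sum]
      simp only [apply_ite (Coalgebra.counit (R := k)), f'.counit_idemBasis, map_zero]
      rw [f.counit_idemBasis, Finset.sum_eq_single 0]
      · simp [eq_comm]
      · intro i _ hi
        simp [hi]
      · simp
    map_comp_comul := f.idemBasis.ext fun j => by
      change TensorProduct.map ν.toLinearMap ν.toLinearMap
        (Coalgebra.comul (R := k) (f.idemBasis j)) = Coalgebra.comul (R := k) (ν (f.idemBasis j))
      rw [hν, map_sum, f.comul_idemBasis, map_sum]
      simp only [apply_ite (Coalgebra.comul (R := k)), f'.comul_idemBasis, map_zero,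
        TensorProduct.map_tmul, AlgHom.toLinearMap_apply, hν, TensorProduct.sum_tmul,
        TensorProduct.tmul_sum, TensorProduct.ite_tmul, TensorProduct.tmul_ite]
      have h1 : ∀ l x, (if φ x = j - l then ∑ y, if φ y = l then
          f'.idemBasis y ⊗ₜ[k] f'.idemBasis x else 0 else 0) = ∑ y, if φ y = l then
          if φ x = j - l then f'.idemBasis y ⊗ₜ[k] f'.idemBasis x else 0 else 0 := fun l x => by
        split_ifs <;> simp
      have h2 : ∀ x, (if φ x = j then ∑ y, f'.idemBasis y ⊗ₜ[k] f'.idemBasis (x - y) else 0) =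
          ∑ y, if φ x = j then f'.idemBasis y ⊗ₜ[k] f'.idemBasis (x - y) else 0 := fun x => by
        split_ifs <;> simp
      simp only [h1, h2]
      rw [Finset.sum_comm]
      conv_lhs =>
        enter [2, x]
        rw [Finset.sum_comm]
      simp only [Finset.sum_ite_eq, Finset.mem_univ, if_true]
      rw [Finset.sum_comm]
      conv_rhs => rw [Finset.sum_comm]
      refine Finset.sum_congr rfl fun y _ => ?_
      -- Replacing x by x - y turns the condition φ(x) = j - φ(y) into φ(x) = j, which is where
      -- additivity of `φ` enters.
      rw [← Equiv.sum_comp (Equiv.subRight y)]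
      simp }

theorem AlgEquiv.apply_functionBialgHom {H' G' : Type*} [Ring H'] [Algebra k H'] [Fintype G']
    [DecidableEq G'] [AddCommGroup G'] (f : H ≃ₐ[k] (G → k)) (f' : H' ≃ₐ[k] (G' → k))
    (φ : G' →+ G) (h : H) (i : G') : f' (f.functionBialgHom f' φ h) i = f h (φ i) :=
  congrFun (f'.apply_symm_apply _) i

/-- The action of an algebra of functions on a space with a basis, in which the basis vectors are
eigenvectors. -/
noncomputable def AlgEquiv.diagonalAction {k H G B : Type*} [Field k] [Ring H] [Algebra k H]
    [AddCommGroup B] [Module k B] (f : H ≃ₐ[k] (G → k)) (b : Module.Basis G k B) :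
    H →ₐ[k] Module.End k B :=
  AlgHom.ofLinearMap
    { toFun h := b.constr k fun l => f h l • b l
      map_add' h h' := b.ext fun l => by simp [add_smul]
      map_smul' c h := b.ext fun l => by simp [mul_smul] }
    (b.ext fun l => by simp)
    (fun h h' => b.ext fun l => by simp [smul_smul, mul_comm])

theorem AlgEquiv.diagonalAction_basis {k H G B : Type*} [Field k] [Ring H] [Algebra k H]
    [AddCommGroup B] [Module k B] (f : H ≃ₐ[k] (G → k)) (b : Module.Basis G k B) (h : H) (l : G) :
    f.diagonalAction b h (b l) = f h l • b l :=
  b.constr_basis k _ l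

/-- An algebra of functions on a group acts on a `G`-graded algebra with one-dimensional components
as on a module algebra. -/
theorem AlgEquiv.isModuleAlgebra_diagonalAction {B : Type*} [Ring B] [Algebra k B]
    (f : H ≃ₐ[k] (G → k)) (b : Module.Basis G k B)
    (hb : ∀ i j, ∃ c : k, b i * b j = c • b (i + j)) (h1 : b 0 = 1) :
    letI := f.functionHopfAlgebra
    IsModuleAlgebra (f.diagonalAction b) := by
  let _ := f.functionHopfAlgebra
  refine ⟨fun h x y => ?_, fun h => ?_⟩
  · let F : B →ₗ[k] B →ₗ[k] H →ₗ[k] B := LinearMap.mk₂ k (fun x y =>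
      LinearMap.mul' k B ∘ₗ TensorProduct.map ((f.diagonalAction b).toLinearMap.flip x)
        ((f.diagonalAction b).toLinearMap.flip y) ∘ₗ Coalgebra.comul)
      (fun x x' y => by simp [TensorProduct.map_add_left, LinearMap.add_comp, LinearMap.comp_add])
      (fun c x y => by simp [TensorProduct.map_smul_left, LinearMap.smul_comp, LinearMap.comp_smul])
      (fun x y y' => by simp [TensorProduct.map_add_right, LinearMap.add_comp, LinearMap.comp_add])
      (fun c x y => by
        simp [TensorProduct.map_smul_right, LinearMap.smul_comp, LinearMap.comp_smul])
    let F' : B →ₗ[k] B →ₗ[k] H →ₗ[k] B :=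
      (LinearMap.mul k B).compr₂ (f.diagonalAction b).toLinearMap.flip
    -- The identity is trilinear, so it suffices to test e_j on a product of basis vectors of
    -- degrees l and l'. In Δ(e_j) only e_l ⊗ e_(j-l) can act nontrivially, and it does so exactly
    -- when j = l + l'.
    have : F' = F := b.ext fun l => b.ext fun l' => f.idemBasis.ext fun j => by
      change f.diagonalAction b (f.idemBasis j) (b l * b l') = LinearMap.mul' k B
        (TensorProduct.map ((f.diagonalAction b).toLinearMap.flip (b l))
        ((f.diagonalAction b).toLinearMap.flip (b l')) (Coalgebra.comul (R := k) (f.idemBasis j)))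
      obtain ⟨c, hc⟩ := hb l l'
      rw [f.comul_idemBasis, hc, map_smul, f.diagonalAction_basis, map_sum, map_sum]
      simp only [TensorProduct.map_tmul, LinearMap.mul'_apply, LinearMap.flip_apply,
        AlgHom.toLinearMap_apply, f.diagonalAction_basis, f.apply_idemBasis, Pi.single_apply,
        smul_mul_smul_comm, hc]
      rw [Finset.sum_eq_single l]
      · simp only [if_true, one_mul, eq_sub_iff_add_eq, add_comm l' l]
        split_ifs <;> simp
      · intro i _ hi
        simp [hi.symm]
      · simp
    exact congr(($this x y) h)
  · have : (f.diagonalAction b).toLinearMap.flip 1 =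
        LinearMap.smulRight (Coalgebra.counit (R := k) (A := H)) (1 : B) :=
      f.idemBasis.ext fun j => by
        rw [LinearMap.smulRight_apply, f.counit_idemBasis, LinearMap.flip_apply,
          AlgHom.toLinearMap_apply, ← h1, f.diagonalAction_basis, f.apply_idemBasis,
          Pi.single_apply]
        simp only [eq_comm]
    exact LinearMap.congr_fun this h

end DualGroupAlgebra

/-! ### The algebra `H_n` as functions on ℤ/p^n -/

namespace RadicalTower

namespace Nondegenerate

variable {p : ℕ} [hp : Fact p.Prime] {Ω : Type*} [Field Ω] {k : Type*} [Field k] {a : k}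
  [Algebra k Ω] {T : RadicalTower p a Ω}

-- Every p^n-th root of unity is a power of ζ_n, which `N_n` fixes.
omit hp in
theorem apply_of_mem_N [NeZero p] {n : ℕ} {σ : T.Γ n} (hσ : σ ∈ T.N n) {x : T.L n}
    (hx : x ^ p ^ n = 1) : σ x = x := by
  obtain ⟨i, -, rfl⟩ := (T.ζL_prim n).eq_pow_of_pow_eq_one hx
  rw [map_pow, (T.mem_N n σ).1 hσ]

theorem wL_ne_zero (hT : T.Nondegenerate) (n : ℕ) : T.wL n ≠ 0 := fun h =>
  hT.w_ne_zero n (congrArg Subtype.val h)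

theorem div_wL_pow (hT : T.Nondegenerate) (n : ℕ) (σ : T.Γ n) :
    (σ (T.wL n) / T.wL n) ^ p ^ n = 1 := by
  have hw : T.wL n ^ p ^ n = algebraMap k (T.L n) a := Subtype.ext (T.w_pow n)
  rw [div_pow, ← map_pow, hw, AlgEquiv.commutes, ← hw, div_self (pow_ne_zero _ (hT.wL_ne_zero n))]

/-- The character `σ ↦ σ(w n) / w n` of the group `N_n`. -/
noncomputable def char (hT : T.Nondegenerate) (n : ℕ) : T.N n →* T.L n where
  toFun σ := (σ : T.Γ n) (T.wL n) / T.wL n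
  map_one' := div_self (hT.wL_ne_zero n)
  map_mul' σ τ := by
    -- In general τ ↦ τ(w)/w is only a cocycle; it is a homomorphism on `N_n` because `N_n` fixes
    -- its values.
    have h := apply_of_mem_N σ.2 (hT.div_wL_pow n τ)
    rw [map_div₀, div_eq_iff ((map_ne_zero _).2 (hT.wL_ne_zero n))] at h
    rw [Subgroup.coe_mul, AlgEquiv.mul_apply, h, mul_div_assoc, mul_comm]

theorem apply_wL (hT : T.Nondegenerate) (n : ℕ) (σ : T.N n) :
    (σ : T.Γ n) (T.wL n) = hT.char n σ * T.wL n :=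
  (div_mul_cancel₀ _ (hT.wL_ne_zero n)).symm

theorem char_eq_of_apply_wL (hT : T.Nondegenerate) {n : ℕ} {σ : T.N n} {c : T.L n}
    (h : (σ : T.Γ n) (T.wL n) = c * T.wL n) : hT.char n σ = c := by
  rw [hT.apply_wL] at h
  exact mul_right_cancel₀ (hT.wL_ne_zero n) h

theorem char_pow (hT : T.Nondegenerate) (n : ℕ) (σ : T.N n) : hT.char n σ ^ p ^ n = 1 :=
  hT.div_wL_pow n σ

theorem char_injective (hT : T.Nondegenerate) (n : ℕ) : Function.Injective (hT.char n) := by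
  intro σ τ h
  apply Subtype.ext
  apply AlgEquiv.coe_toAlgHom_injective
  refine IntermediateField.algHom_ext_of_eq_adjoin k rfl ?_
  rintro x (rfl | rfl)
  · exact ((T.mem_N n σ).1 σ.2).trans ((T.mem_N n τ).1 τ.2).symm
  · change (σ : T.Γ n) (T.wL n) = (τ : T.Γ n) (T.wL n)
    rw [hT.apply_wL, hT.apply_wL, h]

omit hp in
theorem apply_wL_of_mem_Δ {n : ℕ} {δ : T.Γ n} (hδ : δ ∈ T.Δ n) : δ (T.wL n) = T.wL n := by
  rw [Δ, IntermediateField.mem_fixingSubgroup_iff] at hδ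
  exact hδ _ ((IntermediateField.mem_restrict _ _).2 (T.wK n).2)

/-- Since δ and δ⁻¹ fix `w`, δσδ⁻¹ sends `w` to δ(σ(w)) = δ(χ(σ)) w. -/
theorem char_conj (hT : T.Nondegenerate) {n : ℕ} {δ : T.Γ n} (hδ : δ ∈ T.Δ n) (σ : T.N n) :
    hT.char n (MulAut.conjNormal δ σ) = δ (hT.char n σ) := by
  apply hT.char_eq_of_apply_wL
  have h1 : δ⁻¹ (T.wL n) = T.wL n := apply_wL_of_mem_Δ (inv_mem hδ)
  rw [MulAut.conjNormal_apply, AlgEquiv.mul_apply, AlgEquiv.mul_apply, h1, hT.apply_wL, map_mul,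
    apply_wL_of_mem_Δ hδ]

theorem natCast_ne_zero [CharZero k] (T : RadicalTower p a Ω) (n : ℕ) :
    ((p ^ n : ℕ) : T.L n) ≠ 0 := by
  have : CharZero (T.L n) := charZero_of_injective_algebraMap (algebraMap k (T.L n)).injective
  exact Nat.cast_ne_zero.2 (pow_ne_zero _ hp.out.ne_zero)

theorem finite_N (T : RadicalTower p a Ω) (n : ℕ) : Finite (T.N n) := by
  have := T.finiteDimensional_L n
  infer_instance

theorem diag_single (n : ℕ) (γ : T.Γ n) (σ : T.N n) (c : T.L n) :
    T.diag n γ (.single σ c) = .single (MulAut.conjNormal γ σ) (γ c) := by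
  simp [diag]

/-- On Fourier values the conjugation is absorbed by `char_conj`, so that descent along Δ_n can be
done one value at a time. -/
theorem charEval_diag (hT : T.Nondegenerate) {n : ℕ} {δ : T.Γ n} (hδ : δ ∈ T.Δ n) (s : ℕ)
    (x : T.GroupAlg n) : MonoidAlgebra.charEval (hT.char n) s (T.diag n δ x) =
      δ (MonoidAlgebra.charEval (hT.char n) s x) := by
  induction x using MonoidAlgebra.induction_linear with
  | zero => simp
  | add x y hx hy => simp only [map_add, hx, hy]
  | single σ c =>
    rw [diag_single, MonoidAlgebra.charEval_single, MonoidAlgebra.charEval_single,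
      hT.char_conj hδ, map_mul, map_pow]

theorem mem_fixedRing {n : ℕ} {x : T.GroupAlg n} : x ∈ T.fixedRing n ↔
    (∀ σ, x.coeff σ ∈ IntermediateField.restrict (T.E_le_L n)) ∧
      ∀ δ ∈ T.Δ n, T.diag n δ x = x := by
  rw [fixedRing, Subring.mem_inf]
  refine and_congr ?_ ?_
  · have h := MonoidAlgebra.range_map (M := T.N n)
      (algebraMap (IntermediateField.restrict (T.E_le_L n)) (T.L n)).toAddMonoidHom
    have h' := Set.ext_iff.1 h x
    refine Iff.trans ?_ (h'.trans ?_)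
    · rfl
    · refine forall_congr' fun σ => ⟨?_, fun h => ⟨⟨_, h⟩, rfl⟩⟩
      rintro ⟨y, hy⟩
      rw [← hy]
      exact y.2
  · simp only [Subring.mem_iInf]
    rfl

/-- An element of `k(ζ n, w n)` that is fixed by `N_n` and by `Δ_n` belongs to `k`. -/
theorem exists_algebraMap_eq [CharZero k] (hT : T.Nondegenerate) {n : ℕ} {x : T.L n}
    (hN : ∀ σ ∈ T.N n, σ x = x) (hΔ : ∀ δ ∈ T.Δ n, δ x = x) :
    ∃ q : k, algebraMap k (T.L n) q = x := by
  have := T.isGalois_L n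
  have := T.finiteDimensional_L n
  have := finite_N T n
  have := Fintype.ofFinite (T.N n)
  have hxK : x ∈ IntermediateField.restrict (T.K_le_L n) := by
    rw [← IsGalois.fixedField_fixingSubgroup (IntermediateField.restrict (T.K_le_L n)),
      IntermediateField.mem_fixedField_iff]
    exact hΔ
  rw [IntermediateField.mem_restrict] at hxK
  set q := (hT.basisK n).repr ⟨x, hxK⟩ with hq
  have hx : x = ∑ l : ZMod (p ^ n), algebraMap k (T.L n) (q l) * T.wL n ^ l.val := by
    change IntermediateField.inclusion (T.K_le_L n) ⟨x, hxK⟩ = _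
    rw [← (hT.basisK n).sum_repr ⟨x, hxK⟩, map_sum]
    refine Finset.sum_congr rfl fun l _ => ?_
    rw [Algebra.smul_def, map_mul, AlgHom.commutes, hT.basisK_apply, map_pow, ← hq, T.inclusion_wK]
  refine ⟨q 0, ?_⟩
  -- Invariance under Δ_n makes `x` a combination of powers of `w` over `k`. Summation over `N_n`
  -- kills every power but the zeroth, whereas the invariant `x` is merely multiplied by p^n.
  have h1 : ∑ σ : T.N n, (σ : T.Γ n) x = ((p ^ n : ℕ) : T.L n) * algebraMap k (T.L n) (q 0) := by
    rw [hx]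
    simp only [map_sum, map_mul, AlgEquiv.commutes, map_pow, hT.apply_wL, mul_pow]
    rw [Finset.sum_comm]
    simp only [← Finset.mul_sum, ← Finset.sum_mul,
      sum_pow_of_injective (hT.char_injective n) (hT.card_N n), ZMod.natCast_zmod_val]
    rw [Finset.sum_eq_single 0]
    · rw [ZMod.val_zero, pow_zero, if_pos rfl, mul_one, mul_comm]
    · intro l _ hl
      rw [if_neg hl, zero_mul, mul_zero]
    · simp
  have h2 : ∑ σ : T.N n, (σ : T.Γ n) x = ((p ^ n : ℕ) : T.L n) * x := by
    rw [Finset.sum_congr rfl fun (σ : T.N n) _ => hN (σ : T.Γ n) σ.2, Finset.sum_const, Finset.card_univ,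
      ← Nat.card_eq_fintype_card, hT.card_N, nsmul_eq_mul]
  exact mul_left_cancel₀ (natCast_ne_zero T n) (h1.symm.trans h2)

/-- The value is fixed by `N_n`, since the coefficients of `h` lie in k(ζ_n) and those of χ are
roots of unity, and by Δ_n, since `h` is invariant under the diagonal action. -/
theorem exists_coord [CharZero k] (hT : T.Nondegenerate) {n : ℕ} (h : T.H n) (s : ℕ) :
    ∃ q : k, algebraMap k (T.L n) q = MonoidAlgebra.charEval (hT.char n) s (T.incl n h) := by
  obtain ⟨hE, hΔ⟩ := mem_fixedRing.1 h.2
  refine hT.exists_algebraMap_eq (fun σ hσ => ?_) fun δ hδ => ?_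
  · rw [MonoidAlgebra.charEval_apply, Finsupp.sum, map_sum]
    refine Finset.sum_congr rfl fun τ _ => ?_
    rw [map_mul, map_pow, apply_of_mem_N hσ (hT.char_pow n τ)]
    congr 1
    rw [N, IntermediateField.mem_fixingSubgroup_iff] at hσ
    exact hσ _ (hE τ)
  · rw [← hT.charEval_diag hδ]
    exact congrArg _ (hΔ δ hδ)

/-- The eigenvalue of the element `h` of `H_n` on the `j`-th power of `w n`. -/
noncomputable def coordFun [CharZero k] (hT : T.Nondegenerate) (n : ℕ) (h : T.H n)
    (j : ZMod (p ^ n)) : k := (hT.exists_coord h j.val).choose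

theorem algebraMap_coordFun [CharZero k] (hT : T.Nondegenerate) (n : ℕ) (h : T.H n)
    (j : ZMod (p ^ n)) : algebraMap k (T.L n) (hT.coordFun n h j) =
      MonoidAlgebra.charEval (hT.char n) j.val (T.incl n h) := (hT.exists_coord h j.val).choose_spec

theorem incl_injective (T : RadicalTower p a Ω) (n : ℕ) : Function.Injective (T.incl n) :=
  Subtype.val_injective

theorem eq_of_charEval_eq [CharZero k] (hT : T.Nondegenerate) {n : ℕ} {x y : T.GroupAlg n}
    (h : ∀ j : ZMod (p ^ n), MonoidAlgebra.charEval (hT.char n) j.val x =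
      MonoidAlgebra.charEval (hT.char n) j.val y) : x = y :=
  have := finite_N T n
  MonoidAlgebra.eq_of_charEval_eq (hT.char_injective n) (hT.card_N n) (natCast_ne_zero T n) h

theorem char_mem (hT : T.Nondegenerate) (n : ℕ) (σ : T.N n) :
    hT.char n σ ∈ IntermediateField.restrict (T.E_le_L n) := by
  have : NeZero (p ^ n) := ⟨pow_ne_zero _ hp.out.ne_zero⟩
  obtain ⟨i, -, hi⟩ := (T.ζL_prim n).eq_pow_of_pow_eq_one (hT.char_pow n σ)
  have h1 : T.ζL n ∈ IntermediateField.restrict (T.E_le_L n) :=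
    (IntermediateField.mem_restrict _ _).2
      (IntermediateField.subset_adjoin _ _ (Set.mem_singleton _))
  exact hi ▸ pow_mem h1 i

/-- The inverse Fourier transform of `f` is the witness. Its coefficients involve only elements of k
and values of χ, so they lie in k(ζ_n); it is invariant because Δ_n fixes its values, which are in
k. -/
theorem exists_of_values [CharZero k] (hT : T.Nondegenerate) (n : ℕ) (f : ZMod (p ^ n) → k) :
    ∃ x : T.H n, ∀ j : ZMod (p ^ n),
      MonoidAlgebra.charEval (hT.char n) j.val (T.incl n x) = algebraMap k (T.L n) (f j) := by
  have := finite_N T n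
  have hx (j : ZMod (p ^ n)) : MonoidAlgebra.charEval (hT.char n) j.val
      (MonoidAlgebra.charSum (hT.char n) fun i => algebraMap k (T.L n) (f i)) =
        algebraMap k (T.L n) (f j) := by
    rw [MonoidAlgebra.charEval_charSum (hT.char_injective n) (hT.card_N n) (natCast_ne_zero T n),
      ZMod.natCast_zmod_val]
  have hmem : MonoidAlgebra.charSum (hT.char n) (fun i => algebraMap k (T.L n) (f i)) ∈
      T.fixedRing n := by
    refine mem_fixedRing.2 ⟨fun σ => ?_, fun δ hδ => hT.eq_of_charEval_eq fun j => ?_⟩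
    · rw [MonoidAlgebra.coeff_charSum]
      exact sum_mem fun j _ => mul_mem (IntermediateField.algebraMap_mem _ _)
        (mul_mem (inv_mem (natCast_mem _ _)) (pow_mem (hT.char_mem n σ) _))
    · rw [hT.charEval_diag hδ, hx, AlgEquiv.commutes]
  exact ⟨(⟨_, hmem⟩ : T.fixedRing n), hx⟩

theorem coordFun_bijective [CharZero k] (hT : T.Nondegenerate) (n : ℕ) :
    Function.Bijective (hT.coordFun n) := by
  refine ⟨fun h h' hh => incl_injective T n (hT.eq_of_charEval_eq fun j => ?_), fun f => ?_⟩
  · rw [← algebraMap_coordFun, ← algebraMap_coordFun, hh]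
  · obtain ⟨x, hx⟩ := hT.exists_of_values n f
    refine ⟨x, funext fun j => (algebraMap k (T.L n)).injective ?_⟩
    rw [algebraMap_coordFun, hx]

theorem coordFun_mul [CharZero k] (hT : T.Nondegenerate) (n : ℕ) (x y : T.H n) :
    hT.coordFun n (x * y) = hT.coordFun n x * hT.coordFun n y := by
  funext j
  apply (algebraMap k (T.L n)).injective
  rw [Pi.mul_apply, map_mul, algebraMap_coordFun, algebraMap_coordFun, algebraMap_coordFun,
    map_mul, map_mul]

theorem coordFun_add [CharZero k] (hT : T.Nondegenerate) (n : ℕ) (x y : T.H n) :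
    hT.coordFun n (x + y) = hT.coordFun n x + hT.coordFun n y := by
  funext j
  apply (algebraMap k (T.L n)).injective
  rw [Pi.add_apply, map_add, algebraMap_coordFun, algebraMap_coordFun, algebraMap_coordFun,
    map_add, map_add]

/-- `H_n` is isomorphic to the algebra of functions on the integers modulo `p ^ n`, by way of the
eigenvalues on the powers of `w n`. -/
noncomputable def coord [CharZero k] (hT : T.Nondegenerate) (n : ℕ) :
    T.H n ≃+* (ZMod (p ^ n) → k) where
  __ := Equiv.ofBijective (hT.coordFun n) (hT.coordFun_bijective n)
  map_mul' := hT.coordFun_mul n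
  map_add' := hT.coordFun_add n

/-- `coordFun` uses the representatives below p^n; arbitrary exponents are needed later, because
powers of `w_i` become high powers of `w_j`. -/
theorem charEval_incl [CharZero k] (hT : T.Nondegenerate) (n : ℕ) (h : T.H n) (s : ℕ) :
    MonoidAlgebra.charEval (hT.char n) s (T.incl n h) =
      algebraMap k (T.L n) (hT.coord n h s) := by
  have := finite_N T n
  refine Eq.trans ?_ (hT.algebraMap_coordFun n h s).symm
  rw [MonoidAlgebra.charEval_apply, MonoidAlgebra.charEval_apply]
  refine Finsupp.sum_congr fun σ _ => ?_
  rw [pow_eq_of_natCast_eq (hT.card_N n) σ (ZMod.natCast_zmod_val (s : ZMod (p ^ n)))]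

end Nondegenerate

end RadicalTower

/-! ### Diagonal actions and the maps between the groups ℤ/p^n -/

section Diagonal

/-- Writing x as the sum of the c_i ⊗ e_i, the associated map sends the basis vector `b i` to c_i *
`u i`. Since `u i` is a unit, the c_i are determined by the map and can be prescribed. -/
theorem evalMap_bijective_of_diagonal {k A B H ι : Type*} [Field k] [Ring A] [Algebra k A]
    [AddCommGroup B] [Module k B] [Ring H] [Algebra k H] [Fintype ι] [DecidableEq ι] (f : H ≃ₐ[k] (ι → k))
    (b : Module.Basis ι k B) {act : H →ₗ[k] B →ₗ[k] A} {u : ι → A} (hu : ∀ i, IsUnit (u i))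
    (hact : ∀ h i, act h (b i) = f h i • u i) : Function.Bijective (evalMap act) := by
  let E := TensorProduct.equivFinsuppOfBasisRight (M := A) f.idemBasis
  have key : ∀ x i, evalMap act x (b i) = E x i * u i := by
    intro x i
    induction x with
    | zero => simp
    | add x y hx hy => rw [map_add, LinearMap.add_apply, hx, hy, map_add, Finsupp.add_apply, add_mul]
    | tmul a h =>
      rw [evalMap_tmul, hact, TensorProduct.equivFinsuppOfBasisRight_apply_tmul_apply,
        mul_smul_comm, smul_mul_assoc]
      rfl
  refine ⟨fun x y hxy => E.injective (Finsupp.ext fun i => ?_), fun g => ?_⟩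
  · rw [← (hu i).mul_left_inj, ← key, ← key, hxy]
  · refine ⟨E.symm (Finsupp.equivFunOnFinite.symm fun i => g (b i) * ↑(hu i).unit⁻¹),
      b.ext fun i => ?_⟩
    rw [key, E.apply_symm_apply, Finsupp.equivFunOnFinite_symm_apply_apply, mul_assoc,
      IsUnit.val_inv_mul, mul_one]

theorem AlgEquiv.counit_eq_apply_zero {k H G : Type*} [Field k] [Ring H] [Algebra k H] [Fintype G]
    [DecidableEq G] [AddCommGroup G] (f : H ≃ₐ[k] (G → k)) (h : H) :
    letI := f.functionHopfAlgebra
    Coalgebra.counit (R := k) h = f h 0 := by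
  let _ := f.functionHopfAlgebra
  have : Coalgebra.counit (R := k) (A := H) = LinearMap.proj 0 ∘ₗ f.toLinearMap :=
    f.idemBasis.ext fun j => by
      rw [f.counit_idemBasis, LinearMap.comp_apply, AlgEquiv.toLinearMap_apply, f.apply_idemBasis,
        LinearMap.proj_apply, Pi.single_apply]
      simp only [eq_comm]
  exact LinearMap.congr_fun this h

theorem MonoidAlgebra.counit_eq_charEval_zero {R N : Type*} [Field R] [Group N] (χ : N →* R)
    (x : MonoidAlgebra R N) : Coalgebra.counit (R := R) x = charEval χ 0 x := by
  induction x using MonoidAlgebra.induction_linear with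
  | zero => simp
  | add x y hx hy => rw [map_add, map_add, hx, hy]
  | single σ c => simp [charEval_single]

/-- Multiplication by `p ^ (j - i)` as a homomorphism from the integers modulo `p ^ i` to the
integers modulo `p ^ j`. -/
def ZMod.mulPow (p : ℕ) {i j : ℕ} (hij : i ≤ j) : ZMod (p ^ i) →+ ZMod (p ^ j) :=
  ZMod.lift (p ^ i) ⟨(AddMonoidHom.mulLeft ((p ^ (j - i) : ℕ) : ZMod (p ^ j))).comp
    (Int.castAddHom _), by
      change ((p ^ (j - i) : ℕ) : ZMod (p ^ j)) * (((p ^ i : ℕ) : ℤ) : ZMod (p ^ j)) = 0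
      rw [Int.cast_natCast, ← Nat.cast_mul, ← pow_add, Nat.sub_add_cancel hij,
        ZMod.natCast_self]⟩

theorem ZMod.mulPow_natCast (p : ℕ) {i j : ℕ} (hij : i ≤ j) (s : ℕ) :
    ZMod.mulPow p hij s = ((p ^ (j - i) * s : ℕ) : ZMod (p ^ j)) := by
  rw [mulPow, ← Int.cast_natCast s, ZMod.lift_coe, Nat.cast_mul]
  exact congrArg (((p ^ (j - i) : ℕ) : ZMod (p ^ j)) * ·) (Int.cast_natCast s)

end Diagonal

/-! ### Action, coproduct and transition maps in coordinates -/

namespace RadicalTower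

variable {p : ℕ} [hp : Fact p.Prime] {Ω : Type*} [Field Ω] {k : Type*} [Field k] {a : k}
  [Algebra k Ω] {T : RadicalTower p a Ω}

omit hp in
theorem inclusion_wK_pow (T : RadicalTower p a Ω) {i j : ℕ} (hij : i ≤ j) (h : T.K i ≤ T.K j)
    (s : ℕ) : IntermediateField.inclusion h (T.wK i ^ s) = T.wK j ^ (p ^ (j - i) * s) := by
  rw [map_pow, pow_mul]
  congr 1
  exact Subtype.ext (T.w_pow_sub hij).symm

namespace Nondegenerate

variable [CharZero k]

/-- The isomorphism of `H_n` with an algebra of functions is `k`-linear. -/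
noncomputable def coordAlg (hT : T.Nondegenerate) (n : ℕ) [Algebra k (T.H n)]
    (hA : ∀ r : k, T.incl n (algebraMap k (T.H n) r) = algebraMap k (T.GroupAlg n) r) :
    T.H n ≃ₐ[k] (ZMod (p ^ n) → k) :=
  AlgEquiv.ofRingEquiv (f := hT.coord n) fun r => funext fun j =>
    (algebraMap k (T.L n)).injective (by
      have h := hT.charEval_incl n (algebraMap k (T.H n) r) j.val
      rw [hA, ZMod.natCast_zmod_val, IsScalarTower.algebraMap_apply k (T.L n),
        AlgHom.commutes] at h
      exact h.symm)

theorem coordAlg_apply (hT : T.Nondegenerate) (n : ℕ) [Algebra k (T.H n)]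
    (hA : ∀ r : k, T.incl n (algebraMap k (T.H n) r) = algebraMap k (T.GroupAlg n) r) (h : T.H n) :
    hT.coordAlg n hA h = hT.coord n h := rfl

/-- This reduces the comparison of comultiplications to `MonoidAlgebra.comul_charIdem`. -/
theorem incl_idemBasis (hT : T.Nondegenerate) (n : ℕ) [Algebra k (T.H n)]
    (hA : ∀ r : k, T.incl n (algebraMap k (T.H n) r) = algebraMap k (T.GroupAlg n) r)
    (j : ZMod (p ^ n)) : haveI := finite_N T n
    T.incl n ((hT.coordAlg n hA).idemBasis j) = MonoidAlgebra.charIdem (hT.char n) j := by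
  have := finite_N T n
  refine hT.eq_of_charEval_eq fun i => ?_
  rw [hT.charEval_incl, ← hT.coordAlg_apply n hA, AlgEquiv.apply_idemBasis,
    MonoidAlgebra.charEval_charIdem (hT.char_injective n) (hT.card_N n) (natCast_ne_zero T n),
    Pi.single_apply]
  split_ifs <;> simp

theorem coord_ext (hT : T.Nondegenerate) {n : ℕ} {h h' : T.H n}
    (hh : ∀ s : ℕ, hT.coord n h s = hT.coord n h' s) : h = h' :=
  (hT.coord n).injective (funext fun j => by simpa using hh j.val)

/-- As σ(w^s) = χ(σ)^s w^s, the eigenvalue on w^s is the sum of the c_σ χ(σ)^s, which is the Fourier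
value at `s`. -/
theorem sum_coeff_mul_pow (hT : T.Nondegenerate) (n : ℕ) (h : T.H n) (s : ℕ) :
    ((T.incl n h).coeff.sum fun σ c => (c : Ω) * ((σ : T.Γ n) (IntermediateField.inclusion
      (T.K_le_L n) (T.wK n ^ s)) : Ω)) = ((hT.coord n h s • T.wK n ^ s : T.K n) : Ω) := by
  have h1 : ∀ σ : T.N n, (σ : T.Γ n) (IntermediateField.inclusion (T.K_le_L n) (T.wK n ^ s)) =
      hT.char n σ ^ s * T.wL n ^ s := fun σ => by
    rw [map_pow, T.inclusion_wK, map_pow, hT.apply_wL, mul_pow]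
  have h2 := congrArg (fun x : T.L n => (x : Ω) * T.w n ^ s) (hT.charEval_incl n h s)
  rw [Algebra.smul_def]
  refine Eq.trans ?_ h2
  simp only [h1, MonoidAlgebra.charEval_apply, Finsupp.sum]
  change _ = (T.L n).val (∑ σ ∈ _, _) * _
  rw [map_sum, Finset.sum_mul]
  refine Finset.sum_congr rfl fun σ _ => ?_
  change _ = (((T.incl n h).coeff σ : Ω) * ((hT.char n σ ^ s : T.L n) : Ω)) * _
  rw [mul_assoc]
  rfl

/-- The character `σ ↦ σ(w n) / w n` with values in `Ω`. -/
noncomputable def charΩ (hT : T.Nondegenerate) (n : ℕ) : T.N n →* Ω :=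
  (algebraMap (T.L n) Ω : T.L n →* Ω).comp (hT.char n)

theorem charEval_inclΩ (hT : T.Nondegenerate) (n : ℕ) (h : T.H n) (s : ℕ) :
    MonoidAlgebra.charEval (hT.charΩ n) s (T.inclΩ n h) = algebraMap k Ω (hT.coord n h s) := by
  have key : ∀ x : T.GroupAlg n, MonoidAlgebra.charEval (hT.charΩ n) s
      (MonoidAlgebra.mapRingHom (T.N n) (algebraMap (T.L n) Ω) x) =
        algebraMap (T.L n) Ω (MonoidAlgebra.charEval (hT.char n) s x) := by
    intro x
    induction x using MonoidAlgebra.induction_linear with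
    | zero => simp
    | add x y hx hy => simp only [map_add, hx, hy]
    | single σ c =>
      rw [MonoidAlgebra.mapRingHom_single, MonoidAlgebra.charEval_single,
        MonoidAlgebra.charEval_single, map_mul, map_pow]
      rfl
  refine (key _).trans ?_
  rw [hT.charEval_incl]
  rfl

-- Apply σ to `w_i` = `w_j`^(p^(j-i)).
omit [CharZero k] in
theorem charΩ_resN (hT : T.Nondegenerate) {i j : ℕ} (hij : i ≤ j) (σ : T.N j) :
    hT.charΩ i (T.resN hij σ) = hT.charΩ j σ ^ p ^ (j - i) := by
  have h1 : IntermediateField.inclusion (T.L_mono hij) (T.wL i) = T.wL j ^ p ^ (j - i) :=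
    Subtype.ext (T.w_pow_sub hij).symm
  have h2 := T.res_apply hij (σ : T.Γ j) (T.wL i)
  have h3 : T.res hij (σ : T.Γ j) (T.wL i) = hT.char i (T.resN hij σ) * T.wL i :=
    hT.apply_wL i (T.resN hij σ)
  rw [h1, map_pow, hT.apply_wL, h3, map_mul, mul_pow, ← h1] at h2
  have h4 := mul_right_cancel₀ ((map_ne_zero _).2 (hT.wL_ne_zero i)) h2
  exact congrArg Subtype.val h4

/-- Fourier values over Ω, where the coefficients from both levels live, detect equality. By
`charΩ_resN`, evaluating a pushed-forward element at the `s`-th power is evaluating the original one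
at the power p^(j-i) s. -/
theorem incl_ν_of_coord (hT : T.Nondegenerate) {i j : ℕ} (hij : i ≤ j) {h : T.H j} {h' : T.H i}
    (hh : ∀ s : ℕ, hT.coord i h' s = hT.coord j h (p ^ (j - i) * s : ℕ)) :
    T.inclΩ i h' = MonoidAlgebra.mapDomainRingHom Ω (T.resN hij) (T.inclΩ j h) := by
  have := finite_N T i
  have hinj : Function.Injective (hT.charΩ i) :=
    (algebraMap (T.L i) Ω).injective.comp (hT.char_injective i)
  have h0 : ((p ^ i : ℕ) : Ω) ≠ 0 := by
    have := (map_ne_zero (algebraMap (T.L i) Ω)).2 (natCast_ne_zero T i)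
    rwa [map_natCast] at this
  refine MonoidAlgebra.eq_of_charEval_eq hinj (hT.card_N i) h0 fun l => ?_
  have key : ∀ (s : ℕ) (x : MonoidAlgebra Ω (T.N j)), MonoidAlgebra.charEval (hT.charΩ i) s
      (MonoidAlgebra.mapDomainRingHom Ω (T.resN hij) x) =
        MonoidAlgebra.charEval (hT.charΩ j) (p ^ (j - i) * s) x := by
    intro s x
    induction x using MonoidAlgebra.induction_linear with
    | zero => simp
    | add x y hx hy => simp only [map_add, hx, hy]
    | single σ c =>
      rw [MonoidAlgebra.mapDomainRingHom_apply, MonoidAlgebra.mapDomain_single,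
        MonoidAlgebra.charEval_single, MonoidAlgebra.charEval_single, hT.charΩ_resN, pow_mul]
  rw [key, hT.charEval_inclΩ, hT.charEval_inclΩ, hh]

end Nondegenerate

end RadicalTower

/-! ### Existence of the Hopf structures and of the inverse system -/

namespace RadicalTower

variable {p : ℕ} [hp : Fact p.Prime] {Ω : Type*} [Field Ω] {k : Type*} [Field k] {a : k}
  [Algebra k Ω] {T : RadicalTower p a Ω}

namespace Nondegenerate

/-- Division of `s` by p^n, using w^(p^n) = a; this is what makes k(w_n) graded by ℤ/p^n. -/
theorem wK_pow_eq_smul (hT : T.Nondegenerate) (n s : ℕ) :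
    T.wK n ^ s = a ^ (s / p ^ n) • hT.basisK n (s : ZMod (p ^ n)) := by
  rw [hT.basisK_apply, ZMod.val_natCast, Algebra.smul_def, map_pow, ← T.wK_pow, ← pow_mul,
    ← pow_add, Nat.div_add_mod]

theorem basisK_mul_basisK (hT : T.Nondegenerate) (n : ℕ) (i j : ZMod (p ^ n)) :
    ∃ c : k, hT.basisK n i * hT.basisK n j = c • hT.basisK n (i + j) := by
  refine ⟨a ^ ((i.val + j.val) / p ^ n), ?_⟩
  rw [hT.basisK_apply, hT.basisK_apply, ← pow_add, hT.wK_pow_eq_smul, Nat.cast_add,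
    ZMod.natCast_zmod_val, ZMod.natCast_zmod_val]

theorem basisK_zero (hT : T.Nondegenerate) (n : ℕ) : hT.basisK n 0 = 1 := by
  rw [hT.basisK_apply, ZMod.val_zero, pow_zero]

theorem diagonalAction_wK_pow (hT : T.Nondegenerate) {n : ℕ} {H : Type*} [Ring H] [Algebra k H]
    (f : H ≃ₐ[k] (ZMod (p ^ n) → k)) (h : H) (s : ℕ) :
    f.diagonalAction (hT.basisK n) h (T.wK n ^ s) = f h s • T.wK n ^ s := by
  rw [hT.wK_pow_eq_smul, map_smul, f.diagonalAction_basis, smul_comm]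

variable [CharZero k]

/-- The algebra structure of `H_n`. -/
@[reducible]
noncomputable def algebraH (hT : T.Nondegenerate) (n : ℕ) : Algebra k (T.H n) :=
  ((hT.coord n).symm.toRingHom.comp (algebraMap k (ZMod (p ^ n) → k))).toAlgebra' fun r x => by
    apply (hT.coord n).injective
    rw [map_mul, map_mul]
    exact mul_comm _ _

theorem incl_algebraMapH (hT : T.Nondegenerate) (n : ℕ) (r : k) :
    letI := hT.algebraH n
    T.incl n (algebraMap k (T.H n) r) = algebraMap k (T.GroupAlg n) r := by
  refine hT.eq_of_charEval_eq fun j => ?_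
  rw [hT.charEval_incl, IsScalarTower.algebraMap_apply k (T.L n) (T.GroupAlg n), AlgHom.commutes]
  change algebraMap k (T.L n) (hT.coord n ((hT.coord n).symm (algebraMap k _ r)) _) = _
  rw [RingEquiv.apply_symm_apply]
  rfl

/-- The isomorphism of `H_n` with an algebra of functions, for the algebra structure of `H_n`. -/
noncomputable def coordH (hT : T.Nondegenerate) (n : ℕ) :
    letI := hT.algebraH n
    T.H n ≃ₐ[k] (ZMod (p ^ n) → k) :=
  letI := hT.algebraH n
  hT.coordAlg n (hT.incl_algebraMapH n)

/-- The Hopf algebra structure of `H_n`. -/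
@[reducible]
noncomputable def hopfAlgebraH (hT : T.Nondegenerate) (n : ℕ) : HopfAlgebra k (T.H n) :=
  letI := hT.algebraH n
  (hT.coordH n).functionHopfAlgebra

theorem incl_counitH (hT : T.Nondegenerate) (n : ℕ) (h : T.H n) :
    letI := hT.hopfAlgebraH n
    algebraMap k (T.L n) (Coalgebra.counit (R := k) h) =
      Coalgebra.counit (R := T.L n) (T.incl n h) := by
  let _ := hT.algebraH n
  rw [MonoidAlgebra.counit_eq_charEval_zero (hT.char n), hT.charEval_incl,
    (hT.coordH n).counit_eq_apply_zero, Nat.cast_zero]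
  rfl

theorem incl_comulH (hT : T.Nondegenerate) (n : ℕ) (h : T.H n) {ι : Type*} :
    letI := hT.hopfAlgebraH n
    ∀ R : Coalgebra.Repr k h ι,
    ∑ i ∈ R.index, T.incl n (R.left i) ⊗ₜ[T.L n] T.incl n (R.right i) =
      Coalgebra.comul (R := T.L n) (T.incl n h) := by
  intro R
  let _ := hT.hopfAlgebraH n
  have := finite_N T n
  let inclA : T.H n →ₗ[k] T.GroupAlg n :=
    { toFun := T.incl n
      map_add' := map_add _
      map_smul' := fun r x => by
        rw [Algebra.smul_def, map_mul, hT.incl_algebraMapH, Algebra.smul_def, RingHom.id_apply] }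
  let Ψ : T.H n ⊗[k] T.H n →ₗ[k] T.GroupAlg n ⊗[T.L n] T.GroupAlg n :=
    TensorProduct.lift (LinearMap.mk₂ k (fun x y => inclA x ⊗ₜ[T.L n] inclA y)
      (fun x x' y => by rw [map_add, TensorProduct.add_tmul])
      (fun c x y => by rw [map_smul, TensorProduct.smul_tmul'])
      (fun x y y' => by rw [map_add, TensorProduct.tmul_add])
      (fun c x y => by rw [map_smul, TensorProduct.tmul_smul]))
  -- Both sides are k-linear and agree on the idempotents, whose coproducts are given by the same
  -- formula in `H_n` and in the group algebra. Passing through Ψ makes the sum independent of the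
  -- representation `R`.
  have hΨ : Ψ ∘ₗ Coalgebra.comul = (Coalgebra.comul (R := T.L n)
      (A := T.GroupAlg n)).restrictScalars k ∘ₗ inclA := (hT.coordH n).idemBasis.ext fun j => by
    have hincl : ∀ i, inclA ((hT.coordH n).idemBasis i) = MonoidAlgebra.charIdem (hT.char n) i :=
      hT.incl_idemBasis n (hT.incl_algebraMapH n)
    rw [LinearMap.comp_apply, (hT.coordH n).comul_idemBasis, map_sum, LinearMap.comp_apply, hincl,
      LinearMap.restrictScalars_apply, MonoidAlgebra.comul_charIdem (hT.char_injective n)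
      (hT.card_N n) (natCast_ne_zero T n)]
    refine Finset.sum_congr rfl fun i _ => ?_
    change inclA _ ⊗ₜ[T.L n] inclA _ = _
    rw [hincl, hincl]
  refine Eq.trans ?_ (LinearMap.congr_fun hΨ h)
  rw [LinearMap.comp_apply, ← R.eq, map_sum]
  rfl

/-- The transition maps `H_j → H_i`. -/
noncomputable def νH (hT : T.Nondegenerate) {i j : ℕ} (hij : i ≤ j) :
    letI := hT.hopfAlgebraH i
    letI := hT.hopfAlgebraH j
    T.H j →ₐc[k] T.H i :=
  letI := hT.algebraH i
  letI := hT.algebraH j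
  (hT.coordH j).functionBialgHom (hT.coordH i) (ZMod.mulPow p hij)

theorem coord_νH (hT : T.Nondegenerate) {i j : ℕ} (hij : i ≤ j) (h : T.H j) (s : ℕ) :
    letI := hT.hopfAlgebraH i
    letI := hT.hopfAlgebraH j
    hT.coord i (hT.νH hij h) s = hT.coord j h (p ^ (j - i) * s : ℕ) := by
  let _ := hT.algebraH i
  let _ := hT.algebraH j
  rw [← ZMod.mulPow_natCast p hij]
  exact (hT.coordH j).apply_functionBialgHom (hT.coordH i) (ZMod.mulPow p hij) h s

/-- The action of `H_n` on `k(w n)`. -/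
noncomputable def actH (hT : T.Nondegenerate) (n : ℕ) :
    letI := hT.hopfAlgebraH n
    T.H n →ₐ[k] Module.End k (T.K n) :=
  letI := hT.algebraH n
  (hT.coordH n).diagonalAction (hT.basisK n)

theorem actH_wK_pow (hT : T.Nondegenerate) (n : ℕ) (h : T.H n) (s : ℕ) :
    letI := hT.hopfAlgebraH n
    hT.actH n h (T.wK n ^ s) = hT.coord n h s • T.wK n ^ s :=
  letI := hT.algebraH n
  hT.diagonalAction_wK_pow (hT.coordH n) h s

theorem actH_apply (hT : T.Nondegenerate) (n : ℕ) (h : T.H n) (x : T.K n) :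
    letI := hT.hopfAlgebraH n
    (hT.actH n h x : Ω) = (T.incl n h).coeff.sum fun σ c =>
      (c : Ω) * ((σ : T.Γ n) (IntermediateField.inclusion (T.K_le_L n) x) : Ω) := by
  let _ := hT.hopfAlgebraH n
  let F : T.K n →ₗ[k] Ω := ∑ σ ∈ (T.incl n h).coeff.support,
    LinearMap.mulLeft k ((T.incl n h).coeff σ : Ω) ∘ₗ (T.L n).val.toLinearMap ∘ₗ
      (σ : T.Γ n).toLinearMap ∘ₗ (IntermediateField.inclusion (T.K_le_L n)).toLinearMap
  have hF : ∀ y, F y = (T.incl n h).coeff.sum fun σ c =>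
      (c : Ω) * ((σ : T.Γ n) (IntermediateField.inclusion (T.K_le_L n) y) : Ω) := fun y => by
    rw [LinearMap.sum_apply]
    rfl
  have hFeq : (T.K n).val.toLinearMap ∘ₗ hT.actH n h = F := (hT.basisK n).ext fun l => by
    rw [hF, hT.basisK_apply, hT.sum_coeff_mul_pow, LinearMap.comp_apply, hT.actH_wK_pow]
    rfl
  rw [← hF, ← hFeq]
  rfl

theorem exists_hopfSystem (hT : T.Nondegenerate) :
    ∃ _ : ∀ n, HopfAlgebra k (T.H n), Nonempty T.HopfSystem := by
  refine ⟨fun n => hT.hopfAlgebraH n, ⟨?_⟩⟩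
  let _ := fun n => hT.hopfAlgebraH n
  exact
  { mono := T.K_mono
    ν := fun hij => hT.νH hij
    ν_refl := fun i h => hT.coord_ext fun s => by
      rw [hT.coord_νH, Nat.sub_self, pow_zero, one_mul]
    ν_trans := fun {i j l} hij hjl h => hT.coord_ext fun s => by
      rw [hT.coord_νH, hT.coord_νH, hT.coord_νH, ← mul_assoc, ← pow_add,
        show l - j + (j - i) = l - i by omega]
    act := fun n => hT.actH n
    isModuleAlgebra := fun n =>
      letI := hT.algebraH n
      (hT.coordH n).isModuleAlgebra_diagonalAction (hT.basisK n) (hT.basisK_mul_basisK n)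
        (hT.basisK_zero n)
    act_ν := fun {i j} hij h b => by
      -- On `w_i`^l = `w_j`^(p^(j-i) l) both sides act by the value of `h` at p^(j-i) l.
      have key : hT.actH j h ∘ₗ (IntermediateField.inclusion (T.K_mono hij)).toLinearMap =
          (IntermediateField.inclusion (T.K_mono hij)).toLinearMap ∘ₗ hT.actH i (hT.νH hij h) :=
        (hT.basisK i).ext fun l => by
          rw [LinearMap.comp_apply, LinearMap.comp_apply, hT.basisK_apply, hT.actH_wK_pow, map_smul,
            AlgHom.toLinearMap_apply, T.inclusion_wK_pow hij, hT.actH_wK_pow, hT.coord_νH]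
      exact LinearMap.congr_fun key b
    incl_algebraMap := hT.incl_algebraMapH
    incl_counit := hT.incl_counitH
    incl_comul := fun n h _ R => hT.incl_comulH n h R
    incl_ν := fun hij h => hT.incl_ν_of_coord hij (hT.coord_νH hij h)
    act_apply := hT.actH_apply }

end Nondegenerate

end RadicalTower

/-! ### Passage to the limit for a general profinite action -/

namespace ProfiniteHopfAction

variable {k Ω : Type*} [Field k] [Field Ω] [Algebra k Ω]
  {F : ℕ → IntermediateField k Ω} {H : ℕ → Type*} [∀ n, Ring (H n)] [∀ n, HopfAlgebra k (H n)]

theorem toEnd_toUnion (P : ProfiniteHopfAction k F H) (x : P.Smash) (n : ℕ) (b : F n) :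
    P.toEnd x (toUnion F n b) = P.evalInto n (x.proj n) b :=
  P.endFun_toUnion x n b

theorem toEnd_smash (P : ProfiniteHopfAction k F H) (c : ↥(⨆ n, F n)) (h : P.limit)
    (b : ↥(⨆ n, F n)) : P.toEnd (P.smash c h) b = c * P.actLimit h b := by
  obtain ⟨n, -, b, rfl⟩ := exists_toUnion P.mono 0 b
  rw [toEnd_toUnion]
  refine (evalMap_tmul (P.actInto n) c _ b).trans ?_
  exact congrArg (c * ·) (P.actFun_toUnion h n b).symm

/-- An endomorphism of the union is determined by its restrictions to the `F n`, and each
restriction comes from exactly one element of K ⊗ H_n, where K is the union. -/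
theorem toEnd_bijective (P : ProfiniteHopfAction k F H)
    (hP : ∀ n, Function.Bijective (P.evalInto n)) : Function.Bijective P.toEnd := by
  refine ⟨fun x y hxy => Subtype.ext (funext fun n => (hP n).1 (LinearMap.ext fun b => ?_)),
    fun g => ?_⟩
  · exact (P.toEnd_toUnion x n b).symm.trans
      ((LinearMap.congr_fun hxy _).trans (P.toEnd_toUnion y n b))
  · choose x hx using fun n => (hP n).2 (g ∘ₗ (toUnion F n).toLinearMap)
    -- The image of `x j` in K ⊗ H_i and `x i` both induce the restriction of `g` to `F i`, so
    -- injectivity at level `i` makes them equal.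
    have hmem : x ∈ P.completedTensor := fun i j hij => by
      refine (hP i).1 (LinearMap.ext fun b => ?_)
      rw [hx i]
      have h1 := LinearMap.congr_fun (hx j) (IntermediateField.inclusion (P.mono hij) b)
      refine Eq.trans ?_ h1
      refine (evalMap_map (P.actInto i) (P.νL hij) (x j) b).trans (evalMap_congr (fun u => ?_) _)
      rw [actInto_apply, P.act_ν hij, toUnion_inclusion]
      rfl
    refine ⟨(⟨x, hmem⟩ : P.completedTensor), LinearMap.ext fun b => ?_⟩
    obtain ⟨n, -, b, rfl⟩ := exists_toUnion P.mono 0 b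
    exact (P.toEnd_toUnion _ n b).trans (LinearMap.congr_fun (hx n) b)

theorem actLimit_measuring (P : ProfiniteHopfAction k F H) (h : P.limit) (n : ℕ) (a b : F n) :
    P.actLimit h (toUnion F n a * toUnion F n b) =
      LinearMap.mul' k ↥(⨆ n, F n) (TensorProduct.map ((P.actInto n).flip a)
        ((P.actInto n).flip b) (Coalgebra.comul (R := k) ((h : ∀ n, H n) n))) := by
  rw [← map_mul]
  refine (P.actFun_toUnion h n (a * b)).trans ?_
  rw [(P.isModuleAlgebra n).measuring]
  generalize Coalgebra.comul (R := k) ((h : ∀ n, H n) n) = t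
  induction t with
  | zero => simp
  | add x y hx hy => simp only [map_add, hx, hy]
  | tmul u v =>
    rw [TensorProduct.map_tmul, TensorProduct.map_tmul, LinearMap.mul'_apply,
      LinearMap.mul'_apply, map_mul]
    rfl

/-- The images of the finitely many basis vectors of `F n` lie in a common `F M`. -/
theorem homIsDirectLimit (P : ProfiniteHopfAction k F H) (n : ℕ) [FiniteDimensional k (F n)] :
    P.HomIsDirectLimit n := by
  intro f
  let b := Module.finBasis k (F n)
  choose m _ y hy using fun i => exists_toUnion P.mono 0 (f (b i))
  let M := max n (Finset.univ.sup m)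
  have hM : ∀ i, m i ≤ M := fun i =>
    (Finset.le_sup (f := m) (Finset.mem_univ i)).trans (le_max_right _ _)
  let g := b.constr k fun i => IntermediateField.inclusion (P.mono (hM i)) (y i)
  refine ⟨M, le_max_left _ _, g, fun c => ?_⟩
  have : f = (toUnion F M).toLinearMap ∘ₗ g := b.ext fun i => by
    rw [LinearMap.comp_apply, b.constr_basis, AlgHom.toLinearMap_apply, toUnion_inclusion, hy]
  rw [this]
  rfl

end ProfiniteHopfAction

/-! ### Hopf–Galois properties of an arbitrary Hopf system -/

namespace RadicalTower

variable {p : ℕ} [hp : Fact p.Prime] {Ω : Type*} [Field Ω] {k : Type*} [Field k] [CharZero k]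
  {a : k} [Algebra k Ω] {T : RadicalTower p a Ω} [∀ n, HopfAlgebra k (T.H n)]

namespace HopfSystem

/-- The isomorphism of `H_n` with an algebra of functions. -/
noncomputable def coord (P : T.HopfSystem) (hT : T.Nondegenerate) (n : ℕ) :
    T.H n ≃ₐ[k] (ZMod (p ^ n) → k) := hT.coordAlg n (P.incl_algebraMap n)

theorem act_wK_pow (P : T.HopfSystem) (hT : T.Nondegenerate) (n : ℕ) (h : T.H n) (s : ℕ) :
    P.act n h (T.wK n ^ s) = P.coord hT n h s • T.wK n ^ s :=
  Subtype.ext ((P.act_apply n h _).trans (hT.sum_coeff_mul_pow n h s))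

theorem act_basisK (P : T.HopfSystem) (hT : T.Nondegenerate) (n : ℕ) (h : T.H n)
    (l : ZMod (p ^ n)) : P.act n h (hT.basisK n l) = P.coord hT n h l • hT.basisK n l := by
  rw [hT.basisK_apply, P.act_wK_pow hT, ZMod.natCast_zmod_val]

omit [CharZero k] [∀ n, HopfAlgebra k (T.H n)] in
theorem basisK_ne_zero (hT : T.Nondegenerate) (n : ℕ) (l : ZMod (p ^ n)) :
    hT.basisK n l ≠ 0 := (hT.basisK n).ne_zero l

theorem counit_eq (P : T.HopfSystem) (hT : T.Nondegenerate) (n : ℕ) (h : T.H n) :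
    Coalgebra.counit (R := k) h = P.coord hT n h 0 := by
  apply (algebraMap k (T.L n)).injective
  rw [P.incl_counit, MonoidAlgebra.counit_eq_charEval_zero (hT.char n), hT.charEval_incl,
    Nat.cast_zero]
  rfl

/-- For an arbitrary system the formula is read off from `act_ν`, by comparing eigenvalues on
`w_i`^s = `w_j`^(p^(j-i) s). -/
theorem coord_ν (P : T.HopfSystem) (hT : T.Nondegenerate) {i j : ℕ} (hij : i ≤ j) (h : T.H j)
    (s : ℕ) : P.coord hT i (P.ν hij h) s = P.coord hT j h (p ^ (j - i) * s : ℕ) := by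
  have h1 := P.act_ν hij h (T.wK i ^ s)
  rw [P.act_wK_pow hT, T.inclusion_wK_pow hij, P.act_wK_pow hT] at h1
  have h2 := (IntermediateField.inclusion (P.mono hij)).toLinearMap.map_smul
    (P.coord hT i (P.ν hij h) s) (T.wK i ^ s)
  rw [AlgHom.toLinearMap_apply, AlgHom.toLinearMap_apply, T.inclusion_wK_pow hij] at h2
  replace h1 := h1.trans h2
  have h0 : T.wK j ≠ 0 := fun h => hT.w_ne_zero j (congrArg Subtype.val h)
  exact (smul_left_injective k (pow_ne_zero _ h0) h1).symm

theorem finrank_H (P : T.HopfSystem) (hT : T.Nondegenerate) (n : ℕ) :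
    Module.finrank k (T.H n) = p ^ n := by
  rw [(P.coord hT n).toLinearEquiv.finrank_eq, Module.finrank_pi, ZMod.card]

/-- The powers of `w_n` are nonzero eigenvectors, hence units in the larger field, so the criterion
for diagonal actions applies. -/
theorem evalUp_bijective (P : T.HopfSystem) (hT : T.Nondegenerate) {n m : ℕ} (h : n ≤ m) :
    Function.Bijective (P.evalUp h) :=
  evalMap_bijective_of_diagonal (P.coord hT n) (hT.basisK n)
    (u := fun l => IntermediateField.inclusion (P.mono h) (hT.basisK n l))
    (fun l => ((map_ne_zero _).2 (basisK_ne_zero hT n l)).isUnit)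
    (fun x l => (congrArg (IntermediateField.inclusion (P.mono h)) (P.act_basisK hT n x l)).trans
      ((IntermediateField.inclusion (P.mono h)).toLinearMap.map_smul _ _))

theorem evalInto_bijective (P : T.HopfSystem) (hT : T.Nondegenerate) (n : ℕ) :
    Function.Bijective (P.evalInto n) :=
  evalMap_bijective_of_diagonal (P.coord hT n) (hT.basisK n)
    (u := fun l => toUnion T.K n (hT.basisK n l))
    (fun l => ((map_ne_zero _).2 (basisK_ne_zero hT n l)).isUnit)
    (fun x l => (congrArg (toUnion T.K n) (P.act_basisK hT n x l)).trans
      ((toUnion T.K n).toLinearMap.map_smul _ _))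

/-- The projection of `k(w n)` onto `k` as an element of `H_n`. -/
noncomputable def proj (P : T.HopfSystem) (hT : T.Nondegenerate) (n : ℕ) : T.H n :=
  (P.coord hT n).idemBasis 0

theorem counit_proj (P : T.HopfSystem) (hT : T.Nondegenerate) (n : ℕ) :
    Coalgebra.counit (R := k) (P.proj hT n) = 1 := by
  rw [P.counit_eq hT, proj, AlgEquiv.apply_idemBasis, Pi.single_eq_same]

theorem act_proj_mem (P : T.HopfSystem) (hT : T.Nondegenerate) (n : ℕ) (x : T.K n) :
    P.act n (P.proj hT n) x = algebraMap k (T.K n) ((hT.basisK n).repr x 0) := by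
  conv_lhs => rw [← (hT.basisK n).sum_repr x]
  rw [map_sum, Finset.sum_eq_single 0]
  · rw [map_smul, P.act_basisK hT, proj, AlgEquiv.apply_idemBasis, Pi.single_eq_same, one_smul,
      hT.basisK_zero, Algebra.algebraMap_eq_smul_one]
  · intro l _ hl
    rw [map_smul, P.act_basisK hT, proj, AlgEquiv.apply_idemBasis, Pi.single_eq_of_ne hl, zero_smul,
      smul_zero]
  · simp

/-- Multiplication by p^(j-i) from ℤ/p^i to ℤ/p^j is injective, so the indicator of 0 pulls back to
the indicator of 0. -/
theorem ν_proj (P : T.HopfSystem) (hT : T.Nondegenerate) {i j : ℕ} (hij : i ≤ j) :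
    P.ν hij (P.proj hT j) = P.proj hT i := by
  apply (P.coord hT i).injective
  funext l
  rw [← ZMod.natCast_zmod_val l, P.coord_ν hT, proj, proj, AlgEquiv.apply_idemBasis,
    AlgEquiv.apply_idemBasis, Pi.single_apply, Pi.single_apply]
  have : p ^ j ∣ p ^ (j - i) * l.val ↔ p ^ i ∣ l.val := by
    rw [show p ^ j = p ^ (j - i) * p ^ i by rw [← pow_add, Nat.sub_add_cancel hij]]
    exact Nat.mul_dvd_mul_iff_left (pow_pos hp.out.pos _)
  simp only [ZMod.natCast_eq_zero_iff, this]

theorem isHopfGaloisAt (P : T.HopfSystem) (hT : T.Nondegenerate) (n : ℕ) : P.IsHopfGaloisAt n := by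
  refine ⟨P.isModuleAlgebra n, ?_, fun x => ⟨fun hx => ?_, ?_⟩⟩
  · exact evalMap_bijective_of_diagonal (P.coord hT n) (hT.basisK n) (u := hT.basisK n)
      (act := (P.act n).toLinearMap) (fun l => (basisK_ne_zero hT n l).isUnit) (P.act_basisK hT n)
  -- The idempotent e_0 has counit 1 and projects onto `k`, so a fixed element equals its own
  -- projection.
  · have h1 := hx (P.proj hT n)
    rw [P.counit_proj, one_smul, P.act_proj_mem] at h1
    exact ⟨_, h1⟩
  · rintro ⟨q, rfl⟩ h
    change P.act n h (algebraMap k (T.K n) q) = _ • algebraMap k (T.K n) q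
    rw [Algebra.algebraMap_eq_smul_one, map_smul, (P.isModuleAlgebra n).map_one, smul_comm]

theorem isHopfGalois (P : T.HopfSystem) (hT : T.Nondegenerate) :
    P.toProfiniteHopfAction.IsHopfGalois := by
  refine ⟨P.actLimit_measuring, P.toEnd_bijective (P.evalInto_bijective hT),
    fun x => ⟨fun hx => ?_, ?_⟩⟩
  · obtain ⟨n, -, x, rfl⟩ := exists_toUnion P.mono 0 x
    -- The projections onto `k` at all levels form a single element of `H_∞` of counit 1; testing
    -- `x` against it suffices.
    let e : P.limit := ⟨P.proj hT, fun i j hij => P.ν_proj hT hij⟩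
    have h1 : toUnion T.K n (P.act n (P.proj hT n) x) = P.counit e • toUnion T.K n x :=
      (P.actFun_toUnion e n x).symm.trans (hx e)
    have h2 : P.counit e = 1 := (P.toProfiniteHopfAction.counit_eq e n).trans (P.counit_proj hT n)
    rw [h2, one_smul, P.act_proj_mem, AlgHom.commutes] at h1
    exact ⟨_, h1⟩
  · rintro ⟨q, rfl⟩ h
    change P.actLimit h (algebraMap k _ q) = P.counit h • algebraMap k _ q
    -- By linearity only h(1) = ε(h) is needed, and 1 already lies in the bottom field of the tower.
    have h1 := P.actFun_toUnion h 0 1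
    rw [(P.isModuleAlgebra 0).map_one] at h1
    have h2 := h1.trans ((toUnion T.K 0).toLinearMap.map_smul _ 1)
    rw [AlgHom.toLinearMap_apply, map_one, ← P.toProfiniteHopfAction.counit_eq h 0] at h2
    rw [Algebra.algebraMap_eq_smul_one, map_smul, smul_comm]
    exact congrArg (q • ·) h2

end HopfSystem

end RadicalTower

/-! ### The main theorem -/

theorem mainTheorem2 (p : ℕ) [Fact p.Prime] (hp : p ≠ 2) (a : ℚ)
    (ha : ∀ n : ℕ, 1 ≤ n → ∀ b : ℚ, b ^ p ^ n ≠ a)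
    {Ω : Type*} [Field Ω] [Algebra ℚ Ω] (T : RadicalTower p a Ω) :
    (∃ _ : ∀ n, HopfAlgebra ℚ (T.H n), Nonempty T.HopfSystem) ∧
    ∀ [∀ n, HopfAlgebra ℚ (T.H n)] (P : T.HopfSystem),
      (∀ n, Module.finrank ℚ (T.H n) = p ^ n) ∧
      (∀ n, P.IsHopfGaloisAt n) ∧
      (∀ (n m : ℕ) (h : n ≤ m), Function.Bijective (P.evalUp h)) ∧
      (∀ n, P.HomIsDirectLimit n) ∧
      (∀ n, Function.Bijective (P.evalInto n)) ∧
      P.toProfiniteHopfAction.IsHopfGalois ∧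
      ∃ Φ : P.Smash ≃ₐ[ℚ] P.EndUnion,
        (∀ (x : P.Smash) (n : ℕ) (b : T.K n),
          Φ x (toUnion T.K n b) = P.evalInto n (x.proj n) b) ∧
        ∀ (c : ↥(⨆ n, T.K n)) (h : P.limit) (b : ↥(⨆ n, T.K n)),
          Φ (P.smash c h) b = c * P.actLimit h b := by
  -- The case `n = 1` implies the others, since a p^n-th power with n ≥ 1 is a `p`-th power.
  have ha' : ∀ b : ℚ, b ^ p ≠ a := fun b => by simpa using ha 1 le_rfl b
  have hT := T.nondegenerate hp ha'
  refine ⟨hT.exists_hopfSystem, fun P => ⟨P.finrank_H hT, P.isHopfGaloisAt hT,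
    fun n m h => P.evalUp_bijective hT h, fun n => ?_, P.evalInto_bijective hT,
    P.isHopfGalois hT,
    AlgEquiv.ofBijective P.toEnd (P.toEnd_bijective (P.evalInto_bijective hT)),
    P.toEnd_toUnion, P.toEnd_smash⟩⟩
  have := (hT.basisK n).finiteDimensional_of_finite
  exact P.homIsDirectLimit n
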